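/- Let $\mathbb{Z}_{\max}=(\mathbb{Z}\cup\{-\infty\},\max,+)$ be the tropical semiring, in which the product of square matrices is $(AB)_{i,j}=\max_k(A_{i,k}+B_{k,j})$, and let $\|M\|_\infty$ denote the maximal entry of a matrix $M$. For a nonempty finite set $\Gamma$ of $d\times d$ matrices over $\mathbb{Z}_{\max}$, $d\ge 1$, the (lower) joint spectral radius is $$\rho(\Gamma)=\inf\Bigl\{\tfrac1\ell\,\|M_1\cdots M_\ell\|_\infty \;:\; \ell>0,\ M_1,\dots,M_\ell\in\Gamma\Bigr\}\in\mathbb{R}\cup\{-\infty\}.$$ 1. The joint spectral radius is not computable: there is no algorithm which takes as input a nonempty finite set $\Gamma$ of square matrices over $\mathbb{Z}_{\max}$ of a common dimension and outputs the exact value $\rho(\Gamma)$, written in any system of names for (extended) real numbers in which it is decidable from a name whether the number named is $\ge 0$. 2. The following problem is undecidable: given a set $\Gamma$ of $3$ square matrices of a common (arbitrary) dimension with entries in $\{-\infty,-1,0,1\}$, determine whether $\rho(\Gamma)\ge 0$. 3. The following problem is undecidable: given a set $\Gamma$ of $7$ matrices of dimension $554$ with entries in $\mathbb{Z}_{\max}$,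 determine whether $\rho(\Gamma)\ge 0$. -/

import Mathlib

namespace TropicalJSR

/-- The underlying set `ℤ ∪ {-∞}` of the tropical semiring; the semiring addition is `max = ⊔`,
the semiring multiplication is `+`, with `-∞ = ⊥` absorbing. -/
abbrev ZMax : Type := WithBot ℤ

instance : Primcodable ZMax := inferInstanceAs (Primcodable (Option ℤ))

/-- Square matrices of dimension `d` over the tropical semiring. -/
abbrev Mat (d : ℕ) : Type := Matrix (Fin d) (Fin d) ZMax

/-- Tropical product: `(A B) i j = max_k (A i k + B k j)`. -/
def Mat.mul {d : ℕ} (A B : Mat d) : Mat d :=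
  fun i j => Finset.univ.sup fun k => A i k + B k j

/-- Tropical identity matrix: `0` on the diagonal, `-∞` elsewhere. -/
def Mat.one (d : ℕ) : Mat d :=
  fun i j => if i = j then 0 else ⊥

/-- Tropical product `M₁ ⋯ M_ℓ` of a finite sequence of matrices. -/
def Mat.prod {d : ℕ} (w : List (Mat d)) : Mat d :=
  w.foldr Mat.mul (Mat.one d)

/-- The maximal entry of a matrix. -/
def Mat.maxEntry {d : ℕ} (A : Mat d) : ZMax :=
  Finset.univ.sup fun p : Fin d × Fin d => A p.1 p.2

/-- The inclusion of `ℤ ∪ {-∞}` in the extended reals. -/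
noncomputable def toEReal : ZMax → EReal :=
  WithBot.recBotCoe ⊥ (fun n : ℤ => ((n : ℝ) : EReal))

/-- The tropical joint spectral radius (with an infimum): the infimum, over all `ℓ > 0` and all
`M₁, …, M_ℓ ∈ Γ`, of the maximal entry of `M₁ ⋯ M_ℓ` divided by `ℓ`. -/
noncomputable def jointSpectralRadius {d : ℕ} (Γ : Set (Mat d)) : EReal :=
  ⨅ (w : List (Mat d)) (_ : 0 < w.length ∧ ∀ A ∈ w, A ∈ Γ),
    toEReal (Mat.maxEntry (Mat.prod w)) / (w.length : EReal)

/-- A nonempty finite set of matrices of one positive dimension, as it is given to an algorithm: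
listed without repetition. -/
structure Input where
  dim : ℕ
  dim_pos : 0 < dim
  mats : List (Mat dim)
  mats_ne_nil : mats ≠ []
  nodup : mats.Nodup

/-- The finite data presented to an algorithm: the list of the matrices, each matrix being the
list of its rows, each row being the list of its entries. -/
abbrev Code : Type := List (List (List ZMax))

/-- The encoding of an input. -/
def Input.code (x : Input) : Code :=
  x.mats.map fun A => List.ofFn fun i => List.ofFn fun j => A i j

/-- The joint spectral radius of the set of matrices listed in an input. -/
noncomputable def Input.radius (x : Input) : EReal :=
  jointSpectralRadius {A | A ∈ x.mats}

/-- The sets of exactly `k` matrices, of any dimension, with entries in `S`. -/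
def inputs (k : ℕ) (S : Set ZMax) : Set Input :=
  {x | x.mats.length = k ∧ ∀ A ∈ x.mats, ∀ i j, A i j ∈ S}

/-- The sets of exactly `k` matrices of dimension `d` with entries in `S`. -/
def inputsOfDim (d k : ℕ) (S : Set ZMax) : Set Input :=
  {x | x ∈ inputs k S ∧ x.dim = d}

/-- The property `p` of inputs is decidable on the class `C`: some algorithm answers correctly on
every input of the class (and may answer anything outside the class). -/
def DecidableOn (C : Set Input) (p : Input → Prop) : Prop :=
  ∃ f : Code → Bool, Computable f ∧ ∀ x ∈ C, (f x.code = true ↔ p x)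

/-- An algorithm can output the joint spectral radius exactly. The outputs are taken in some
system of names `α` for extended reals, with `val a` the number named by `a`, in which one can
decide from a name whether the number is nonnegative (such as rational or algebraic numbers
together with `-∞`; names that are programs for approximations do not qualify). -/
def RadiusComputable : Prop :=
  ∃ (α : Type) (_ : Primcodable α) (val : α → EReal) (f : Code → α),
    ComputablePred (fun a => 0 ≤ val a) ∧ Computable f ∧ ∀ x : Input, val (f x.code) = x.radius

end TropicalJSR

/-!
# Undecidability of the sign of the tropical joint spectral radius

The entries of a tropical product are the maximal weights of the paths in a weighted automaton, so
`0 ≤ ρ(Γ)` says that each word over `Γ` labels a path of nonnegative weight, between any two states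
(`coe_le_prod_iff`, `zero_le_radius_iff`). Initial and final states are enforced by one more matrix,
a reset letter leading from the final to the initial states with weight `0`: if a word `s` has only
negative paths from initial to final states, then a high power of the word `s` followed by a reset
has only negative paths at all. Conversely, if each word has a nonnegative path from an initial to a final
state, such paths can be joined by resets. The question becomes whether each word has a nonnegative
path from an initial to a final state (`MaxPlusAut.zero_le_radius_toInput`), and an isolated state
with different loops keeps the matrices distinct.

Whether some word has only negative paths is undecidable, already when the automaton varies only
through an additive parameter `n` in some weights (`exists_undecidable_family`). Let a Turing
machine with undecidable halting problem be fixed, obtained here from Mathlib's compilation of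
partial recursive functions (`exists_undecidable_TM0`). Its configurations are read as vectors of
numbers: the state, the scanned symbol, and the two halves of the tape. To keep the number of
conditions independent of the unknown number of rules, the whole table of rules is written as the
digits of one number `P`, which is a further entry of the vectors. A step drops the lowest digit of
`P`, restores `P` to its initial value, or drops a digit and applies it as a rule. Each kind of step
is described by a few linear equations and inequalities between consecutive vectors
(`machineConstraints`, `linHalts_iff`), and the input of the machine is the constant of one of the
equations. A word over six letters writes a sequence of vectors in unary together with the types of
the steps. The automaton `checker` guesses a violation: a vector that breaks off, the end of
the word before a halting vector, or two consecutive vectors and a constraint, whose linear form it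
evaluates as the weight of the path. So a word without nonnegative path is a halting run
(`exists_word_iff`). Fifty-four slots for constraints, ten states each, and fourteen other states
give dimension `554`, and six letters and the reset give seven matrices.

For three matrices with entries in `{-∞, -1, 0, 1}`, each of the six letters is written as a block
of `n + c` bits, and the weight `b + ε n` of a transition is spread over the block as a weight `ε`
on each of the first `n` bits and `|b|` units on the rest (`sum_stepWeight`,
`forall_nonneg_bin_iff`). The dimension then grows with `n`, and only finitely many transitions
between states occur at each pair of positions, so that the matrices are computable from `n`.
-/

namespace TropicalJSR

/-! ### Weighted automata and the joint spectral radius -/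

/-- A max-plus automaton with letters `A` and states `σ`: the entry `wt a p q` is the weight of the
transition `p → q` labelled `a`, where `⊥` means that there is no such transition. The weights of
the initial and final states are all `0`. -/
structure MaxPlusAut (A σ : Type) where
  wt : A → σ → σ → ZMax
  init : σ → Bool
  fin : σ → Bool

/-- `Path W w p q z`: there is a path from `p` to `q` labelled by the word `w`, of weight `z`. -/
def Path {A σ : Type} (W : A → σ → σ → ZMax) : List A → σ → σ → ℤ → Prop
  | [], p, q, z => p = q ∧ z = 0
  | a :: w, p, q, z => ∃ r x y, W a p r = ((x : ℤ) : ZMax) ∧ Path W w r q y ∧ z = x + y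

section Path

variable {A σ : Type} {W : A → σ → σ → ZMax}

theorem path_append {u v : List A} {p q : σ} {z : ℤ} :
    Path W (u ++ v) p q z ↔ ∃ r x y, Path W u p r x ∧ Path W v r q y ∧ z = x + y := by
  induction u generalizing p z with
  | nil =>
    constructor
    · intro h
      exact ⟨p, 0, z, ⟨rfl, rfl⟩, h, by ring⟩
    · rintro ⟨r, x, y, ⟨rfl, rfl⟩, h, rfl⟩
      simpa using h
  | cons a u ih =>
    simp only [List.cons_append, Path, ih]
    constructor
    · rintro ⟨r, x, y, h1, ⟨r', x', y', h2, h3, rfl⟩, rfl⟩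
      exact ⟨r', x + x', y', ⟨r, x, x', h1, h2, rfl⟩, h3, by ring⟩
    · rintro ⟨r', x', y', ⟨r, x, y, h1, h2, rfl⟩, h3, rfl⟩
      exact ⟨r, x, y + y', h1, ⟨r', y, y', h2, h3, rfl⟩, by ring⟩

theorem path_singleton {a : A} {p q : σ} {z : ℤ} :
    Path W [a] p q z ↔ W a p q = (z : ZMax) := by
  constructor
  · rintro ⟨r, x, y, h, ⟨rfl, rfl⟩, rfl⟩
    simpa using h
  · intro h
    exact ⟨q, z, 0, h, ⟨rfl, rfl⟩, by ring⟩

/-- The entries of a tropical product are the maximal weights of the paths. -/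
theorem coe_le_prod_iff {d : ℕ} (M : A → Mat d) (w : List A) (i j : Fin d) (z : ℤ) :
    (z : ZMax) ≤ Mat.prod (w.map M) i j ↔ ∃ z', z ≤ z' ∧ Path M w i j z' := by
  induction w generalizing i z with
  | nil =>
    simp only [List.map_nil, Mat.prod, List.foldr_nil, Mat.one, Path]
    split_ifs with h
    · constructor
      · intro hz
        exact ⟨0, by exact_mod_cast hz, h, rfl⟩
      · rintro ⟨z', hz, -, rfl⟩
        exact_mod_cast hz
    · simp [h]
  | cons a w ih =>
    have hb : (⊥ : ZMax) < (z : ZMax) := WithBot.bot_lt_coe z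
    have key : Mat.prod ((a :: w).map M) i j
        = Finset.univ.sup fun k => M a i k + Mat.prod (w.map M) k j := rfl
    rw [key, Finset.le_sup_iff hb]
    constructor
    · rintro ⟨k, -, hk⟩
      induction hx : M a i k using WithBot.recBotCoe with
      | bot => rw [hx, WithBot.bot_add] at hk; exact absurd hk (not_le.2 hb)
      | coe x =>
        have h2 : ((z - x : ℤ) : ZMax) ≤ Mat.prod (w.map M) k j := by
          induction hy : Mat.prod (w.map M) k j using WithBot.recBotCoe with
          | bot => rw [hy, WithBot.add_bot] at hk; exact absurd hk (not_le.2 hb)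
          | coe y =>
            rw [hx, hy, ← WithBot.coe_add, WithBot.coe_le_coe] at hk
            rw [WithBot.coe_le_coe]
            linarith
        obtain ⟨z', hz', hp⟩ := (ih k (z - x)).1 h2
        exact ⟨x + z', by linarith, k, x, z', hx, hp, rfl⟩
    · rintro ⟨z', hz', k, x, y, hx, hp, rfl⟩
      refine ⟨k, Finset.mem_univ _, ?_⟩
      have h2 : ((z - x : ℤ) : ZMax) ≤ Mat.prod (w.map M) k j :=
        (ih k (z - x)).2 ⟨y, by linarith, hp⟩
      rw [hx]
      calc (z : ZMax) = (x : ZMax) + ((z - x : ℤ) : ZMax) := by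
            rw [← WithBot.coe_add]; congr 1; ring
        _ ≤ _ := by gcongr

theorem zero_le_maxEntry_iff {d : ℕ} (M : A → Mat d) (w : List A) :
    0 ≤ Mat.maxEntry (Mat.prod (w.map M)) ↔ ∃ i j z, 0 ≤ z ∧ Path M w i j z := by
  have hb : (⊥ : ZMax) < ((0 : ℤ) : ZMax) := WithBot.bot_lt_coe _
  change ((0 : ℤ) : ZMax) ≤ _ ↔ _
  rw [Mat.maxEntry, Finset.le_sup_iff hb]
  simp only [coe_le_prod_iff, Finset.mem_univ, true_and, Prod.exists]

theorem path_bounded [Fintype σ] (w : List A) :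
    ∃ C : ℤ, ∀ p q z, Path W w p q z → z ≤ C := by
  induction w with
  | nil => exact ⟨0, by rintro p q z ⟨-, rfl⟩; rfl⟩
  | cons a w ih =>
    obtain ⟨C, hC⟩ := ih
    obtain ⟨D, hD⟩ := (Set.finite_range fun x : σ × σ => (W a x.1 x.2).unbotD 0).bddAbove
    refine ⟨D + C, ?_⟩
    rintro p q z ⟨r, x, y, hx, hy, rfl⟩
    have h1 : x ≤ D := by
      have := hD ⟨(p, r), rfl⟩
      simpa [hx] using this
    linarith [hC _ _ _ hy]

theorem path_equiv {τ : Type} (e : σ ≃ τ) (w : List A) (p q : σ) (z : ℤ) :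
    Path (fun a i j => W a (e.symm i) (e.symm j)) w (e p) (e q) z ↔ Path W w p q z := by
  induction w generalizing p z with
  | nil => simp [Path]
  | cons a w ih =>
    simp only [Path, Equiv.symm_apply_apply]
    constructor
    · rintro ⟨r, x, y, hx, hy, rfl⟩
      refine ⟨e.symm r, x, y, hx, ?_, rfl⟩
      rw [← ih]; simpa using hy
    · rintro ⟨r, x, y, hx, hy, rfl⟩
      exact ⟨e r, x, y, by simpa using hx, (ih _ _).2 hy, rfl⟩

end Path

theorem zero_le_toEReal_div {x : ZMax} {n : ℕ} (hn : 0 < n) :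
    0 ≤ toEReal x / (n : EReal) ↔ 0 ≤ x := by
  have hn' : (0 : ℝ) < n := by exact_mod_cast hn
  induction x using WithBot.recBotCoe with
  | bot =>
    have h1 : toEReal ⊥ = ⊥ := rfl
    have h2 : (⊥ : EReal) / ((n : ℝ) : EReal) = ⊥ :=
      EReal.bot_div_of_pos_ne_top (by exact_mod_cast hn') (EReal.coe_ne_top _)
    rw [h1, show ((n : ℕ) : EReal) = ((n : ℝ) : EReal) from rfl, h2]
    simp
  | coe z =>
    have h1 : toEReal (z : ZMax) = ((z : ℝ) : EReal) := rfl
    rw [h1, show ((n : ℕ) : EReal) = ((n : ℝ) : EReal) from rfl, ← EReal.coe_div]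
    have h3 : (0 : ZMax) ≤ (z : ZMax) ↔ 0 ≤ z := by
      change ((0 : ℤ) : ZMax) ≤ _ ↔ _
      rw [WithBot.coe_le_coe]
    rw [h3, EReal.coe_nonneg, div_nonneg_iff]
    constructor
    · rintro (⟨h, -⟩ | ⟨-, h⟩)
      · exact_mod_cast h
      · linarith
    · intro h
      exact Or.inl ⟨by exact_mod_cast h, hn'.le⟩

theorem zero_le_radius_iff (x : Input) :
    0 ≤ x.radius ↔ ∀ w : List (Mat x.dim), 0 < w.length → (∀ A ∈ w, A ∈ x.mats) →
      0 ≤ Mat.maxEntry (Mat.prod w) := by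
  simp only [Input.radius, jointSpectralRadius, le_iInf_iff, Set.mem_ofPred_eq, and_imp]
  refine forall_congr' fun w => forall_congr' fun h => forall_congr' fun _ => ?_
  exact zero_le_toEReal_div h

namespace MaxPlusAut

variable {A σ : Type} (𝒜 : MaxPlusAut A σ)

/-- The word `s` labels a path of nonnegative weight from an initial to a final state. -/
def Nonneg (s : List A) : Prop :=
  ∃ p q z, 𝒜.init p = true ∧ 𝒜.fin q = true ∧ Path 𝒜.wt s p q z ∧ 0 ≤ z

/-- The automaton with one more letter, `none`, which leads from each final state to each initial
state with weight `0`. -/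
def resetWt : Option A → σ → σ → ZMax
  | some a => 𝒜.wt a
  | none => fun p q => if 𝒜.fin p && 𝒜.init q then 0 else ⊥

theorem path_map_some {s : List A} {p q : σ} {z : ℤ} :
    Path 𝒜.resetWt (s.map some) p q z ↔ Path 𝒜.wt s p q z := by
  induction s generalizing p z with
  | nil => rfl
  | cons a s ih => simp only [List.map_cons, Path, ih]; rfl

theorem resetWt_none {p q : σ} {z : ℤ} :
    𝒜.resetWt none p q = (z : ZMax) ↔ 𝒜.fin p = true ∧ 𝒜.init q = true ∧ z = 0 := by
  change (if 𝒜.fin p && 𝒜.init q then (0 : ZMax) else ⊥) = _ ↔ _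
  split_ifs with h
  · rw [Bool.and_eq_true] at h
    simp only [h, true_and]
    constructor
    · intro h2
      have : ((0 : ℤ) : ZMax) = (z : ZMax) := h2
      exact (WithBot.coe_injective this).symm
    · rintro rfl; rfl
  · simp only [Bool.and_eq_true, not_and] at h
    constructor
    · intro h2; exact absurd h2 (by simp)
    · rintro ⟨h1, h2, -⟩; exact absurd h2 (h h1)

theorem word_split (w : List (Option A)) :
    (∃ v : List A, w = v.map some) ∨
      ∃ (u : List A) (w' : List (Option A)), w = u.map some ++ none :: w' := by
  induction w with
  | nil => exact Or.inl ⟨[], rfl⟩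
  | cons a w ih =>
    cases a with
    | none => exact Or.inr ⟨[], w, rfl⟩
    | some a =>
      rcases ih with ⟨v, rfl⟩ | ⟨u, w', rfl⟩
      · exact Or.inl ⟨a :: v, rfl⟩
      · exact Or.inr ⟨a :: u, w', rfl⟩

theorem exists_path_of_nonneg (h : ∀ s, 𝒜.Nonneg s) (n : ℕ) :
    ∀ w : List (Option A), w.length ≤ n → ∃ v : List A, ∀ r m z, 𝒜.init r = true →
      Path 𝒜.wt v r m z → ∃ r' z', 𝒜.init r' = true ∧ z ≤ z' ∧ Path 𝒜.resetWt w r' m z' := by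
  induction n with
  | zero =>
    intro w hw
    obtain rfl : w = [] := List.eq_nil_of_length_eq_zero (by omega)
    exact ⟨[], fun r m z hr hp => ⟨r, z, hr, le_rfl, hp⟩⟩
  | succ n ih =>
    intro w hw
    rcases word_split w with ⟨v, rfl⟩ | ⟨u, w', rfl⟩
    · exact ⟨v, fun r m z hr hp => ⟨r, z, hr, le_rfl, 𝒜.path_map_some.2 hp⟩⟩
    · obtain ⟨v, hv⟩ := ih w' (by simp at hw; omega)
      refine ⟨v, fun r m z hr hp => ?_⟩
      obtain ⟨r', z', hr', hz', hp'⟩ := hv r m z hr hp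
      obtain ⟨p, q, z₁, hp₁, hq₁, hpath, hz₁⟩ := h u
      refine ⟨p, z₁ + z', hp₁, by linarith, path_append.2 ⟨q, z₁, z', ?_, ?_, rfl⟩⟩
      · exact 𝒜.path_map_some.2 hpath
      · exact ⟨r', 0, z', 𝒜.resetWt_none.2 ⟨hq₁, hr', rfl⟩, hp', by ring⟩

/-- If every word has a nonnegative path from an initial to a final state, and some state has a
nonnegative loop on each letter, then every word with resets labels a nonnegative path. A word
`u # ⋯ # v` is treated by cutting the nonnegative path of `v u` at the end of `v`. -/
theorem exists_nonneg_path (h : ∀ s, 𝒜.Nonneg s) (o : σ)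
    (ho : ∀ a, ∃ z : ℤ, 0 ≤ z ∧ 𝒜.wt a o o = (z : ZMax)) (w : List (Option A)) :
    ∃ p q z, 0 ≤ z ∧ Path 𝒜.resetWt w p q z := by
  rcases word_split w with ⟨v, rfl⟩ | ⟨u, w', rfl⟩
  · refine ⟨o, o, ?_⟩
    induction v with
    | nil => exact ⟨0, le_rfl, rfl, rfl⟩
    | cons a v ih =>
      obtain ⟨z, hz, hp⟩ := ih
      obtain ⟨x, hx, hx'⟩ := ho a
      exact ⟨x + z, by positivity, o, x, z, hx', hp, rfl⟩
  · obtain ⟨v, hv⟩ := 𝒜.exists_path_of_nonneg h _ w' le_rfl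
    obtain ⟨p, q, z, hp, hq, hpath, hz⟩ := h (v ++ u)
    obtain ⟨m, x, y, hx, hy, rfl⟩ := path_append.1 hpath
    obtain ⟨r', z', hr', hz', hp'⟩ := hv p m x hp hx
    refine ⟨m, m, y + z', by linarith, path_append.2 ⟨q, y, z', ?_, ?_, rfl⟩⟩
    · exact 𝒜.path_map_some.2 hy
    · exact ⟨r', 0, z', 𝒜.resetWt_none.2 ⟨hq, hr', rfl⟩, hp', by ring⟩

/-- If `s` has no nonnegative path from an initial to a final state, then all paths labelled by a
large power of `s #` have negative weight. -/
theorem exists_negative_word [Fintype σ] (s : List A) (h : ¬ 𝒜.Nonneg s) :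
    ∃ w : List (Option A), w ≠ [] ∧ ∀ p q z, Path 𝒜.resetWt w p q z → z < 0 := by
  set b : List (Option A) := s.map some ++ [none] with hb
  obtain ⟨C, hC⟩ := path_bounded (W := 𝒜.resetWt) b
  have hb1 : ∀ p q z, Path 𝒜.resetWt b p q z → 𝒜.init q = true := by
    intro p q z hp
    obtain ⟨r, x, y, -, h2, -⟩ := path_append.1 hp
    exact (𝒜.resetWt_none.1 (path_singleton.1 h2)).2.1
  have hb2 : ∀ p q z, 𝒜.init p = true → Path 𝒜.resetWt b p q z → z ≤ -1 := by
    intro p q z hi hp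
    obtain ⟨r, x, y, h1, h2, rfl⟩ := path_append.1 hp
    obtain ⟨hr, -, rfl⟩ := 𝒜.resetWt_none.1 (path_singleton.1 h2)
    by_contra hcon
    exact h ⟨p, r, x, hi, hr, 𝒜.path_map_some.1 h1, by omega⟩
  have hpow : ∀ n : ℕ, ∀ p q z, 𝒜.init p = true →
      Path 𝒜.resetWt (List.replicate n b).flatten p q z → z ≤ -n := by
    intro n
    induction n with
    | zero => rintro p q z - ⟨-, rfl⟩; simp
    | succ n ih =>
      intro p q z hi hp
      rw [List.replicate_succ, List.flatten_cons] at hp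
      obtain ⟨r, x, y, h1, h2, rfl⟩ := path_append.1 hp
      have := hb2 _ _ _ hi h1
      have := ih _ _ _ (hb1 _ _ _ h1) h2
      push_cast
      linarith
  refine ⟨b ++ (List.replicate (C.toNat + 1) b).flatten, by simp [hb], ?_⟩
  intro p q z hp
  obtain ⟨r, x, y, h1, h2, rfl⟩ := path_append.1 hp
  have h3 := hC _ _ _ h1
  have h4 := hpow _ _ _ _ (hb1 _ _ _ h1) h2
  have h5 := Int.self_le_toNat C
  push_cast at h4
  linarith

end MaxPlusAut

section AutInput

variable {A σ : Type} {k d : ℕ}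

/-- The matrix of a family of weights, for a numbering `e` of the states. -/
def toMat (e : σ ≃ Fin d) (W : σ → σ → ZMax) : Mat d :=
  fun i j => W (e.symm i) (e.symm j)

/-- The matrices of the reset letter and of the letters of an automaton. A state `o` with distinct
loops on the letters, which is not final, makes them distinct. -/
def MaxPlusAut.toInput (𝒜 : MaxPlusAut A σ) (f : Fin k ≃ A) (e : σ ≃ Fin d)
    (o : σ) (ho : ∀ a : Fin k, 𝒜.wt (f a) o o = (((a : ℕ) : ℤ) : ZMax))
    (hf : 𝒜.fin o = false) : Input where
  dim := d
  dim_pos := (e o).pos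
  mats := toMat e (𝒜.resetWt none) :: List.ofFn fun a => toMat e (𝒜.resetWt (some (f a)))
  mats_ne_nil := List.cons_ne_nil _ _
  nodup := by
    have hval : ∀ x, toMat e (𝒜.resetWt x) (e o) (e o) = 𝒜.resetWt x o o := by
      intro x; simp [toMat]
    rw [List.nodup_cons, List.nodup_ofFn]
    refine ⟨?_, ?_⟩
    · rw [List.mem_ofFn]
      rintro ⟨a, ha⟩
      have h1 := congrFun (congrFun ha (e o)) (e o)
      rw [hval, hval] at h1
      have h2 : 𝒜.resetWt (some (f a)) o o = (((a : ℕ) : ℤ) : ZMax) := ho a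
      rw [h2] at h1
      have h3 := (𝒜.resetWt_none.1 h1.symm).1
      rw [hf] at h3
      exact absurd h3 (by simp)
    · intro a b hab
      have h1 : toMat e (𝒜.resetWt (some (f a))) (e o) (e o)
          = toMat e (𝒜.resetWt (some (f b))) (e o) (e o) := congrFun (congrFun hab (e o)) (e o)
      rw [hval, hval] at h1
      have h2 : (((a : ℕ) : ℤ) : ZMax) = (((b : ℕ) : ℤ) : ZMax) := by
        rw [← ho a, ← ho b]; exact h1
      have h3 : ((a : ℕ) : ℤ) = ((b : ℕ) : ℤ) := WithBot.coe_injective h2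
      exact Fin.ext (by exact_mod_cast h3)

/-- The joint spectral radius is nonnegative exactly when each word over the original letters has a
nonnegative path from an initial to a final state. -/
theorem MaxPlusAut.zero_le_radius_toInput (𝒜 : MaxPlusAut A σ) (f : Fin k ≃ A) (e : σ ≃ Fin d)
    (o : σ) (ho : ∀ a : Fin k, 𝒜.wt (f a) o o = (((a : ℕ) : ℤ) : ZMax)) (hf : 𝒜.fin o = false) :
    0 ≤ (𝒜.toInput f e o ho hf).radius ↔ ∀ s, 𝒜.Nonneg s := by
  have : Fintype σ := Fintype.ofEquiv _ e.symm
  have hpath : ∀ w : List (Option A),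
      0 ≤ Mat.maxEntry (Mat.prod (w.map fun x => toMat e (𝒜.resetWt x))) ↔
        ∃ p q z, 0 ≤ z ∧ Path 𝒜.resetWt w p q z := by
    intro w
    rw [zero_le_maxEntry_iff]
    constructor
    · rintro ⟨i, j, z, hz, hp⟩
      refine ⟨e.symm i, e.symm j, z, hz, ?_⟩
      rw [← path_equiv e, e.apply_symm_apply, e.apply_symm_apply]
      exact hp
    · rintro ⟨p, q, z, hz, hp⟩
      exact ⟨e p, e q, z, hz, (path_equiv e w p q z).2 hp⟩
  have hmem : ∀ M : Mat d, M ∈ (toMat e (𝒜.resetWt none) ::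
      List.ofFn fun a => toMat e (𝒜.resetWt (some (f a)))) ↔ ∃ x, toMat e (𝒜.resetWt x) = M := by
    intro M
    rw [List.mem_cons, List.mem_ofFn]
    constructor
    · rintro (rfl | ⟨a, rfl⟩)
      · exact ⟨none, rfl⟩
      · exact ⟨some (f a), rfl⟩
    · rintro ⟨_ | a, rfl⟩
      · exact Or.inl rfl
      · exact Or.inr ⟨f.symm a, by rw [f.apply_symm_apply]⟩
  rw [zero_le_radius_iff]
  change (∀ w : List (Mat d), 0 < w.length → (∀ M ∈ w, M ∈ toMat e (𝒜.resetWt none) ::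
    List.ofFn fun a => toMat e (𝒜.resetWt (some (f a)))) → 0 ≤ Mat.maxEntry (Mat.prod w)) ↔ _
  constructor
  · intro h s
    by_contra hs
    obtain ⟨w, hw, hneg⟩ := 𝒜.exists_negative_word s hs
    have h1 := h (w.map fun x => toMat e (𝒜.resetWt x))
      (by rw [List.length_map]; exact List.length_pos_iff.2 hw)
      (by
        intro M hM
        obtain ⟨x, -, rfl⟩ := List.mem_map.1 hM
        exact (hmem _).2 ⟨x, rfl⟩)
    obtain ⟨p, q, z, hz, hp⟩ := (hpath w).1 h1
    exact absurd (hneg _ _ _ hp) (not_lt.2 hz)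
  · intro h w hpos hw
    clear hpos
    obtain ⟨w, rfl⟩ : ∃ w' : List (Option A),
        w'.map (fun x => toMat e (𝒜.resetWt x)) = w := by
      have hw' : ∀ M ∈ w, ∃ x, toMat e (𝒜.resetWt x) = M := fun M hM => (hmem M).1 (hw M hM)
      clear hw
      induction w with
      | nil => exact ⟨[], rfl⟩
      | cons M w ih =>
        obtain ⟨x, hx⟩ := hw' M (by simp)
        obtain ⟨w', hw'⟩ := ih (fun M hM => hw' M (List.mem_cons_of_mem _ hM))
        exact ⟨x :: w', by rw [List.map_cons, hx, hw']⟩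
    refine (hpath w).2 (𝒜.exists_nonneg_path h o (fun a => ⟨(f.symm a : ℕ), by positivity, by
      rw [← ho (f.symm a), f.apply_symm_apply]⟩) w)

end AutInput

/-! ### A Turing machine with an undecidable halting problem -/

section BinaryDigits

open Turing.PartrecToTM2

/-- Increment of a list of binary digits, least significant first. -/
def incBits : List Bool → List Bool
  | [] => [true]
  | false :: l => true :: l
  | true :: l => false :: incBits l

/-- The binary digits of a number, least significant first. -/
def bitList : ℕ → List Bool
  | 0 => []
  | n + 1 => incBits (bitList n)

/-- The digits of a list of bits in the alphabet of Mathlib's stack machine. -/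
def bitSymbol : Bool → Γ'
  | true => Γ'.bit1
  | false => Γ'.bit0

theorem trNat_eq_bitList (n : ℕ) : trNat n = (bitList n).map bitSymbol := by
  have hpos : ∀ (p : PosNum) (l : List Bool), trPosNum p = l.map bitSymbol →
      trPosNum p.succ = (incBits l).map bitSymbol := by
    intro p
    induction p with
    | one =>
      intro l h
      match l, h with
      | [true], _ => rfl
    | bit0 p ih =>
      intro l h
      match l, h with
      | false :: l, h => simpa [PosNum.succ, trPosNum, incBits, bitSymbol] using h
      | true :: l, h => simp [trPosNum, bitSymbol] at h
    | bit1 p ih =>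
      intro l h
      match l, h with
      | true :: l, h =>
        simp only [trPosNum, List.map_cons, bitSymbol, List.cons.injEq, true_and] at h
        simp [PosNum.succ, trPosNum, incBits, bitSymbol, ih l h]
      | false :: l, h => simp [trPosNum, bitSymbol] at h
  induction n with
  | zero => simp [bitList]
  | succ n ih =>
    have h1 : ((n + 1 : ℕ) : Num) = (n : Num).succ := by
      rw [Nat.cast_succ, Num.add_one]
    rw [trNat] at ih ⊢
    rw [h1, bitList]
    cases hn : (n : Num) with
    | zero =>
      rw [hn] at ih
      have : bitList n = [] := by simpa [trNum] using ih.symm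
      rw [this]; rfl
    | pos p =>
      rw [hn] at ih
      exact hpos p _ ih

theorem primrec_incBits : Primrec incBits := by
  have h : Primrec fun l : List Bool => (List.rec [true]
      (fun b l ih => cond b (false :: ih) (true :: l)) l : List Bool) := by
    refine Primrec.list_rec (f := fun l : List Bool => l) (g := fun _ => [true])
      (h := fun _ x => cond x.1 (false :: x.2.2) (true :: x.2.1)) Primrec.id (Primrec.const _) ?_
    have h1 : Primrec fun x : List Bool × Bool × List Bool × List Bool => x.2.1 :=
      Primrec.fst.comp Primrec.snd
    have h2 : Primrec fun x : List Bool × Bool × List Bool × List Bool => x.2.2.1 :=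
      Primrec.fst.comp (Primrec.snd.comp Primrec.snd)
    have h3 : Primrec fun x : List Bool × Bool × List Bool × List Bool => x.2.2.2 :=
      Primrec.snd.comp (Primrec.snd.comp Primrec.snd)
    exact Primrec.cond h1 (Primrec.list_cons.comp (Primrec.const _) h3)
      (Primrec.list_cons.comp (Primrec.const _) h2)
  refine h.of_eq fun l => ?_
  induction l with
  | nil => rfl
  | cons b l ih => cases b <;> simp [incBits, ← ih]

theorem primrec_bitList : Primrec bitList := by
  have h : Primrec fun n : ℕ => (Nat.rec [] (fun _ l => incBits l) n : List Bool) :=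
    Primrec.nat_rec' (f := fun n : ℕ => n) (g := fun _ => ([] : List Bool))
      (h := fun _ x => incBits x.2) Primrec.id (Primrec.const _)
      (primrec_incBits.comp (Primrec.snd.comp Primrec.snd))
  refine h.of_eq fun n => ?_
  induction n with
  | zero => rfl
  | succ n ih => simp only [bitList, ← ih]

end BinaryDigits

theorem primrec_ofDigits_map (B : ℕ) (g : Bool → ℕ) :
    Primrec fun l : List Bool => Nat.ofDigits B (l.map g) := by
  have h : Primrec fun l : List Bool => l.foldr (fun b x => g b + B * x) 0 := by
    refine Primrec.list_foldr (f := fun l : List Bool => l) (g := fun _ => 0)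
      (h := fun _ x => g x.1 + B * x.2) Primrec.id (Primrec.const _) ?_
    exact Primrec.nat_add.comp ((Primrec.dom_finite g).comp (Primrec.fst.comp Primrec.snd))
      (Primrec.nat_mul.comp (Primrec.const _) (Primrec.snd.comp Primrec.snd))
  refine h.of_eq fun l => ?_
  induction l with
  | nil => rfl
  | cons b l ih => simp [Nat.ofDigits_cons, ← ih]

/-- Halting on input `0` is undecidable for the codes of partial recursive functions. -/
theorem not_computablePred_dom :
    ¬ ComputablePred fun n : ℕ => (Nat.Partrec.Code.eval (Denumerable.ofNat _ n) 0).Dom := by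
  intro h
  obtain ⟨f, hf, hf'⟩ := ComputablePred.computable_iff.1 h
  apply ComputablePred.halting_problem 0
  rw [ComputablePred.computable_iff]
  refine ⟨fun c => f (Encodable.encode c), hf.comp Computable.encode, ?_⟩
  funext c
  have := congrFun hf' (Encodable.encode c)
  simpa using this

open Turing in
/-- There is a machine in Mathlib's model `TM0`, with finite alphabet and finitely many reachable
labels, whose halting problem is undecidable for a family of inputs which are computable when
they are read as numbers. -/
theorem exists_undecidable_TM0 :
    ∃ (Γ Λ : Type) (_ : Inhabited Γ) (_ : Fintype Γ) (_ : Inhabited Λ) (M : TM0.Machine Γ Λ)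
      (S : Finset Λ) (f : ℕ → List Γ), TM0.Supports M (S : Set Λ) ∧
      (∀ (B : ℕ) (g : Γ → ℕ), Computable fun n => Nat.ofDigits B ((f n).map g)) ∧
      ¬ ComputablePred fun n => (TM0.eval M (f n)).Dom := by
  classical
  have hF : Partrec fun v : List.Vector ℕ 1 =>
      Nat.Partrec.Code.eval (Denumerable.ofNat _ v.head) 0 := by
    refine Nat.Partrec.Code.eval_part.comp ?_ (Computable.const 0)
    exact (Computable.ofNat _).comp Computable.vector_head
  obtain ⟨c, hc⟩ := ToPartrec.Code.exists_code (Nat.Partrec'.part_iff.2 hF)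
  let _ : Inhabited PartrecToTM2.Λ' :=
    ⟨PartrecToTM2.trNormal c PartrecToTM2.Cont'.halt⟩
  let f : ℕ → List (TM2to1.Γ' PartrecToTM2.K' fun _ => PartrecToTM2.Γ') :=
    fun n => TM2to1.trInit PartrecToTM2.K'.main (PartrecToTM2.trList [n])
  have hdom : ∀ n, (TM0.eval (TM1to0.tr (TM2to1.tr PartrecToTM2.tr)) (f n)).Dom ↔
      (Nat.Partrec.Code.eval (Denumerable.ofNat _ n) 0).Dom := by
    intro n
    rw [TM1to0.tr_eval]
    refine (TM2to1.tr_eval_dom _ _ _).trans ?_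
    have h1 : (TM2.init PartrecToTM2.K'.main (PartrecToTM2.trList [n]) :
        PartrecToTM2.Cfg') = PartrecToTM2.init c [n] := by
      unfold TM2.init PartrecToTM2.init
      congr 1
      funext k
      cases k <;> rfl
    have h2 : TM2.eval PartrecToTM2.tr PartrecToTM2.K'.main (PartrecToTM2.trList [n]) =
        (StateTransition.eval (TM2.step PartrecToTM2.tr) (PartrecToTM2.init c [n])).map
          fun c => c.stk PartrecToTM2.K'.main := by
      rw [← h1]; rfl
    have h3 := hc ⟨[n], rfl⟩
    rw [h2, PartrecToTM2.tr_eval]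
    change ((Part.map _ (c.eval [n])).map _).Dom ↔ _
    have h3' : c.eval [n] = Part.map pure
      (Nat.Partrec.Code.eval (Denumerable.ofNat _ n) 0) := h3
    rw [h3']
    rfl
  have hfin : ∃ S : Finset (TM1to0.Λ' (TM2to1.tr PartrecToTM2.tr)),
      TM0.Supports (TM1to0.tr (TM2to1.tr PartrecToTM2.tr))
      (S : Set (TM1to0.Λ' (TM2to1.tr PartrecToTM2.tr))) :=
    ⟨_, TM1to0.tr_supports _ (TM2to1.tr_supports _
      (PartrecToTM2.tr_supports c PartrecToTM2.Cont'.halt))⟩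
  obtain ⟨S, hS⟩ := hfin
  have : Fintype PartrecToTM2.K' :=
    ⟨{.main, .rev, .aux, .stack}, fun k => by cases k <;> simp⟩
  have : Fintype (TM2to1.Γ' PartrecToTM2.K' fun _ => PartrecToTM2.Γ') :=
    TM2to1.Γ'.fintype
  refine ⟨_, _, inferInstance, this, inferInstance, _, S, f, hS, ?_, ?_⟩
  · intro B g
    let upd : PartrecToTM2.Γ' → (∀ k : PartrecToTM2.K', Option PartrecToTM2.Γ') :=
      fun a => Function.update (fun _ => none) PartrecToTM2.K'.main (some a)
    have hf : ∀ n, f n = (true, upd PartrecToTM2.Γ'.cons) ::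
        ((bitList n).reverse.map fun b => (false, upd (bitSymbol b))) := by
      intro n
      have h1 : (PartrecToTM2.trList [n]).reverse =
          PartrecToTM2.Γ'.cons :: ((bitList n).reverse.map bitSymbol) := by
        simp [trNat_eq_bitList]
      simp only [f, TM2to1.trInit]
      rw [h1]
      exact congrArg (List.cons _) List.map_map
    have hP : Primrec fun n : ℕ => g (true, upd PartrecToTM2.Γ'.cons) +
        B * Nat.ofDigits B ((bitList n).reverse.map fun b => g (false, upd (bitSymbol b))) :=
      Primrec.nat_add.comp (Primrec.const _) (Primrec.nat_mul.comp (Primrec.const _)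
        ((primrec_ofDigits_map B _).comp (Primrec.list_reverse.comp primrec_bitList)))
    refine (hP.of_eq fun n => ?_).to_comp
    rw [hf]
    change _ = Nat.ofDigits B (g _ :: List.map g (List.map _ _))
    rw [Nat.ofDigits_cons]
    exact congrArg (fun l => _ + B * Nat.ofDigits B l) List.map_map.symm
  · simp only [hdom]
    exact not_computablePred_dom

/-! ### Turing machines acting on numbers -/

/-- A configuration of a Turing machine in numbers: control state `u`, scanned symbol `s`, and the
left and right parts of the tape read as numbers whose least significant digit is next to the
head. -/
@[ext] structure NumCfg where
  u : ℕ
  s : ℕ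
  L : ℕ
  R : ℕ

/-- A rule of a Turing machine in numbers: in state `u`, scanning `s`, go to state `u'` and move
right (`kind = 1`), move left (`kind = 2`) or write `s'` (`kind = 3`). The field `s'` is `0` for
moves. -/
structure Rule where
  kind : ℕ
  u : ℕ
  s : ℕ
  u' : ℕ
  s' : ℕ

/-- The rule `r` leads from `c` to `d`, on a tape with symbols below `B`. -/
def Rule.Applies (B : ℕ) (r : Rule) (c d : NumCfg) : Prop :=
  c.u = r.u ∧ c.s = r.s ∧ d.u = r.u' ∧
    ((r.kind = 1 ∧ r.s' = 0 ∧ d.s < B ∧ d.L = c.s + B * c.L ∧ c.R = d.s + B * d.R) ∨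
      (r.kind = 2 ∧ r.s' = 0 ∧ d.s < B ∧ d.R = c.s + B * c.R ∧ c.L = d.s + B * d.L) ∨
      (r.kind = 3 ∧ d.s = r.s' ∧ d.L = c.L ∧ d.R = c.R))

/-- Some rule of the list leads from `c` to `d`. -/
def NumStep (B : ℕ) (rules : List Rule) (c d : NumCfg) : Prop :=
  ∃ r ∈ rules, r.Applies B c d

/-- Started in state `1` scanning a blank, with tape `n` to the right, the machine can reach the
halting state `0`. -/
def NumHalts (B : ℕ) (rules : List Rule) (n : ℕ) : Prop :=
  ∃ d, Relation.ReflTransGen (NumStep B rules) ⟨1, 0, 0, n⟩ d ∧ d.u = 0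

/-- The fields of the rule lie in the ranges given by `B` symbols and `K` states. -/
def Rule.Bounded (B K : ℕ) (r : Rule) : Prop :=
  1 ≤ r.kind ∧ r.kind ≤ 3 ∧ r.u < K ∧ r.s < B ∧ r.u' < K ∧ r.s' < B

theorem digit_unique {B a b x y : ℕ} (ha : a < B) (hb : b < B) (h : a + B * x = b + B * y) :
    a = b ∧ x = y := by
  have h1 : a = b := by
    have := congrArg (· % B) h
    simpa [Nat.mod_eq_of_lt ha, Nat.mod_eq_of_lt hb] using this
  subst h1
  have h2 : B * x = B * y := by omega
  exact ⟨rfl, Nat.eq_of_mul_eq_mul_left (by omega) h2⟩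

section Tape

open Turing

variable {Γ : Type} [Inhabited Γ]

/-- A half-infinite tape read as a number in base `B`, when the blank has value `0`. -/
def tapeVal (B : ℕ) (g : Γ → ℕ) (hg : g default = 0) (l : ListBlank Γ) : ℕ :=
  l.liftOn (fun l => Nat.ofDigits B (l.map g)) (by
    rintro a _ ⟨n, rfl⟩
    simp only [List.map_append, List.map_replicate, Nat.ofDigits_append, hg]
    simp)

variable {B : ℕ} {g : Γ → ℕ} {hg : g default = 0}

theorem tapeVal_mk (l : List Γ) :
    tapeVal B g hg (ListBlank.mk l) = Nat.ofDigits B (l.map g) := rfl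

theorem tapeVal_cons (a : Γ) (l : ListBlank Γ) :
    tapeVal B g hg (l.cons a) = g a + B * tapeVal B g hg l := by
  induction l using ListBlank.induction_on with
  | _ l => rw [ListBlank.cons_mk, tapeVal_mk, tapeVal_mk, List.map_cons, Nat.ofDigits_cons]

theorem tapeVal_head_tail (l : ListBlank Γ) :
    tapeVal B g hg l = g l.head + B * tapeVal B g hg l.tail := by
  rw [← tapeVal_cons, ListBlank.cons_head_tail]

end Tape

section Translation

open Turing

variable {Γ Λ : Type} [Inhabited Λ]

/-- The rule performed by a machine in the label `x.1` when it scans `x.2`. If the machine halts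
there, the rule goes to the halting state `0`. -/
def ruleOf (M : TM0.Machine Γ Λ) (lab : Λ → ℕ) (g : Γ → ℕ) (x : Λ × Γ) : Rule :=
  match M x.1 x.2 with
  | none => ⟨3, lab x.1, g x.2, 0, g x.2⟩
  | some (q, TM0.Stmt.move Dir.right) => ⟨1, lab x.1, g x.2, lab q, 0⟩
  | some (q, TM0.Stmt.move Dir.left) => ⟨2, lab x.1, g x.2, lab q, 0⟩
  | some (q, TM0.Stmt.write b) => ⟨3, lab x.1, g x.2, lab q, g b⟩

theorem ruleOf_u (M : TM0.Machine Γ Λ) (lab : Λ → ℕ) (g : Γ → ℕ) (x : Λ × Γ) :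
    (ruleOf M lab g x).u = lab x.1 ∧ (ruleOf M lab g x).s = g x.2 := by
  unfold ruleOf; split <;> exact ⟨rfl, rfl⟩

/-- The rules of a machine with labels in `S`. The first one moves the head from the blank left of
the input to its first symbol. -/
noncomputable def rulesOf [Fintype Γ] (M : TM0.Machine Γ Λ) (S : Finset Λ) (lab : Λ → ℕ)
    (g : Γ → ℕ) : List Rule :=
  ⟨1, 1, 0, lab default, 0⟩ :: (S ×ˢ (Finset.univ : Finset Γ)).toList.map (ruleOf M lab g)

theorem mem_rulesOf [Fintype Γ] {M : TM0.Machine Γ Λ} {S : Finset Λ} {lab : Λ → ℕ} {g : Γ → ℕ}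
    {r : Rule} :
    r ∈ rulesOf M S lab g ↔
      r = ⟨1, 1, 0, lab default, 0⟩ ∨ ∃ q ∈ S, ∃ a, ruleOf M lab g (q, a) = r := by
  simp [rulesOf]

variable [Inhabited Γ] [Fintype Γ] {M : TM0.Machine Γ Λ} {S : Finset Λ} {lab : Λ → ℕ} {B : ℕ}
  {g : Γ → ℕ} {hg : g default = 0}

/-- The configuration in numbers of a configuration of a Turing machine. -/
def encCfg (lab : Λ → ℕ) (B : ℕ) (g : Γ → ℕ) (hg : g default = 0) (c : TM0.Cfg Γ Λ) : NumCfg :=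
  ⟨lab c.q, g c.Tape.head, tapeVal B g hg c.Tape.left, tapeVal B g hg c.Tape.right⟩

theorem numStep_of_step (hgB : ∀ a, g a < B) {c c' : TM0.Cfg Γ Λ} (hc : c.q ∈ S)
    (h : TM0.step M c = some c') :
    NumStep B (rulesOf M S lab g) (encCfg lab B g hg c) (encCfg lab B g hg c') := by
  refine ⟨ruleOf M lab g (c.q, c.Tape.head), mem_rulesOf.2 (Or.inr ⟨_, hc, _, rfl⟩), ?_⟩
  obtain ⟨q, a, L, R⟩ := c
  simp only [TM0.step, Option.map_eq_some_iff] at h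
  obtain ⟨⟨q', st⟩, h1, rfl⟩ := h
  rcases st with d | b
  · cases d
    · simp [ruleOf, h1, Rule.Applies, encCfg, Tape.move, tapeVal_cons, hgB,
        ← tapeVal_head_tail]
    · simp [ruleOf, h1, Rule.Applies, encCfg, Tape.move, tapeVal_cons, hgB,
        ← tapeVal_head_tail]
  · simp [ruleOf, h1, Rule.Applies, encCfg, Tape.write]

theorem numStep_of_halt {c : TM0.Cfg Γ Λ} (hc : c.q ∈ S) (h : TM0.step M c = none) :
    ∃ d, NumStep B (rulesOf M S lab g) (encCfg lab B g hg c) d ∧ d.u = 0 := by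
  obtain ⟨q, a, L, R⟩ := c
  simp only [TM0.step, Option.map_eq_none_iff] at h
  refine ⟨⟨0, g a, tapeVal B g hg L, tapeVal B g hg R⟩,
    ⟨ruleOf M lab g (q, a), mem_rulesOf.2 (Or.inr ⟨_, hc, _, rfl⟩), ?_⟩, rfl⟩
  simp [ruleOf, h, Rule.Applies, encCfg]

theorem step_of_numStep (hgB : ∀ a, g a < B) (hgi : Function.Injective g)
    (hlab : Set.InjOn lab S) (hlab2 : ∀ q ∈ S, 2 ≤ lab q) {c : TM0.Cfg Γ Λ} (hc : c.q ∈ S)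
    {d : NumCfg} (h : NumStep B (rulesOf M S lab g) (encCfg lab B g hg c) d) :
    TM0.step M c = none ∨ ∃ c', TM0.step M c = some c' ∧ d = encCfg lab B g hg c' := by
  obtain ⟨r, hr, happ⟩ := h
  rcases mem_rulesOf.1 hr with rfl | ⟨q, hq, a, rfl⟩
  · have h1 : lab c.q = 1 := happ.1
    have := hlab2 _ hc
    omega
  · have h1 : lab c.q = lab q := happ.1.trans (ruleOf_u ..).1
    have h2 : g c.Tape.head = g a := happ.2.1.trans (ruleOf_u ..).2
    obtain rfl := hlab hc hq h1
    obtain rfl := hgi h2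
    obtain ⟨q, a, L, R⟩ := c
    obtain ⟨-, -, h3, h4⟩ := happ
    simp only [TM0.step, Option.map_eq_none_iff, Option.map_eq_some_iff]
    rcases hM : M q a with _ | ⟨q', st⟩
    · exact Or.inl rfl
    · refine Or.inr ⟨_, ⟨_, rfl, rfl⟩, ?_⟩
      rcases st with dir | b
      · cases dir
        · simp only [ruleOf, hM, encCfg, OfNat.ofNat_ne_one, false_and, true_and, false_or,
            Nat.reduceEqDiff, or_false] at h3 h4
          obtain ⟨hs, hR, hL⟩ := h4
          rw [tapeVal_head_tail L] at hL
          obtain ⟨e1, e2⟩ := digit_unique (hgB _) hs hL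
          ext <;> simp [encCfg, Tape.move, h3, hR, e1, e2, tapeVal_cons]
        · simp only [ruleOf, hM, encCfg, OfNat.one_ne_ofNat, false_and, true_and,
            or_false] at h3 h4
          obtain ⟨hs, hL, hR⟩ := h4
          rw [tapeVal_head_tail R] at hR
          obtain ⟨e1, e2⟩ := digit_unique (hgB _) hs hR
          ext <;> simp [encCfg, Tape.move, h3, hL, e1, e2, tapeVal_cons]
      · simp only [ruleOf, hM, encCfg, OfNat.ofNat_ne_one, false_and, true_and, false_or,
          Nat.reduceEqDiff] at h3 h4
        obtain ⟨hs, hL, hR⟩ := h4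
        ext <;> simp [encCfg, Tape.write, h3, hs, hL, hR]

theorem numStep_start_iff (hgB : ∀ a, g a < B) (hlab2 : ∀ q ∈ S, 2 ≤ lab q) (l : List Γ)
    (d : NumCfg) :
    NumStep B (rulesOf M S lab g) ⟨1, 0, 0, Nat.ofDigits B (l.map g)⟩ d ↔
      d = encCfg lab B g hg (TM0.init l) := by
  have hval : Nat.ofDigits B (l.map g) = tapeVal B g hg (ListBlank.mk l) := rfl
  have hinit : encCfg lab B g hg (TM0.init l) = ⟨lab default, g (ListBlank.mk l).head, 0,
      tapeVal B g hg (ListBlank.mk l).tail⟩ := rfl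
  rw [hval, hinit]
  generalize ListBlank.mk l = T
  constructor
  · rintro ⟨r, hr, happ⟩
    rcases mem_rulesOf.1 hr with rfl | ⟨q, hq, a, rfl⟩
    · obtain ⟨-, -, h3, h4⟩ := happ
      simp only [OfNat.one_ne_ofNat, false_and, true_and, or_false] at h3 h4
      obtain ⟨hs, hL, hR⟩ := h4
      rw [tapeVal_head_tail] at hR
      obtain ⟨e1, e2⟩ := digit_unique (hgB _) hs hR
      ext <;> simp [h3, hL, e1, e2]
    · have h1 : 1 = lab q := happ.1.trans (ruleOf_u ..).1
      have := hlab2 _ hq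
      omega
  · rintro rfl
    refine ⟨_, mem_rulesOf.2 (Or.inl rfl), ?_⟩
    simp [Rule.Applies, hgB, ← tapeVal_head_tail]

theorem numHalts_iff (hgB : ∀ a, g a < B) (hgi : Function.Injective g) (hg : g default = 0)
    (hlab : Set.InjOn lab S) (hlab2 : ∀ q ∈ S, 2 ≤ lab q) (hS : TM0.Supports M (S : Set Λ))
    (l : List Γ) :
    NumHalts B (rulesOf M S lab g) (Nat.ofDigits B (l.map g)) ↔ (TM0.eval M l).Dom := by
  have hdom : (TM0.eval M l).Dom ↔ ∃ c, StateTransition.Reaches (TM0.step M) (TM0.init l) c ∧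
      TM0.step M c = none := by
    change (StateTransition.eval (TM0.step M) (TM0.init l)).Dom ↔ _
    rw [Part.dom_iff_mem]
    simp only [StateTransition.mem_eval]
  have hq : ∀ c, StateTransition.Reaches (TM0.step M) (TM0.init l) c → c.q ∈ S := by
    intro c hc
    induction hc with
    | refl => exact hS.1
    | tail _ h ih => exact TM0.step_supports M hS h ih
  rw [hdom]
  constructor
  · rintro ⟨d, hd, hd0⟩
    by_contra hno
    push Not at hno
    -- as long as the Turing machine does not halt, its configurations are the only reachable ones
    have key : d = ⟨1, 0, 0, Nat.ofDigits B (l.map g)⟩ ∨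
        ∃ c, StateTransition.Reaches (TM0.step M) (TM0.init l) c ∧ d = encCfg lab B g hg c := by
      clear hd0
      induction hd with
      | refl => exact Or.inl rfl
      | tail _ h ih =>
        rcases ih with rfl | ⟨c, hc, rfl⟩
        · rw [numStep_start_iff (hg := hg) hgB hlab2] at h
          exact Or.inr ⟨_, Relation.ReflTransGen.refl, h⟩
        · rcases step_of_numStep hgB hgi hlab hlab2 (hq c hc) h with h0 | ⟨c', h1, rfl⟩
          · exact absurd h0 (hno c hc)
          · exact Or.inr ⟨c', hc.tail h1, rfl⟩
    rcases key with rfl | ⟨c, hc, rfl⟩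
    · exact absurd hd0 one_ne_zero
    · have h1 : lab c.q = 0 := hd0
      have := hlab2 _ (hq c hc)
      omega
  · rintro ⟨c, hc, hnone⟩
    have h1 : Relation.ReflTransGen (NumStep B (rulesOf M S lab g))
        ⟨1, 0, 0, Nat.ofDigits B (l.map g)⟩ (encCfg lab B g hg c) := by
      clear hnone
      induction hc with
      | refl => exact .single ((numStep_start_iff hgB hlab2 l _).2 rfl)
      | tail hb h ih => exact ih.tail (numStep_of_step hgB (hq _ hb) h)
    obtain ⟨d, hd, hd0⟩ := numStep_of_halt (B := B) (lab := lab) (g := g) (hg := hg)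
      (hq c hc) hnone
    exact ⟨d, h1.tail hd, hd0⟩

end Translation

/-- A fixed finite list of rules whose halting problem, as a predicate of the number on the initial
tape, is undecidable. -/
theorem exists_undecidable_rules :
    ∃ (B K : ℕ) (rules : List Rule), 0 < B ∧ 1 < K ∧ (∀ r ∈ rules, r.Bounded B K) ∧
      ¬ ComputablePred (NumHalts B rules) := by
  classical
  obtain ⟨Γ, Λ, _, _, _, M, S, f, hS, hf, hM⟩ := exists_undecidable_TM0
  let e := Fintype.equivFin Γ
  let g : Γ → ℕ := fun a => Equiv.swap (e default) ⟨0, Fintype.card_pos⟩ (e a)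
  have hg : g default = 0 := by simp [g]
  have hgB : ∀ a, g a < Fintype.card Γ := fun a => Fin.is_lt _
  have hgi : Function.Injective g := by
    intro a b hab
    have := Fin.ext hab
    simpa using this
  let lab : Λ → ℕ := fun q => if h : q ∈ S then S.equivFin ⟨q, h⟩ + 2 else 0
  have hlab2 : ∀ q ∈ S, 2 ≤ lab q := by intro q hq; simp [lab, hq]
  have hlabK : ∀ q ∈ S, lab q < S.card + 2 := by
    intro q hq
    simp only [lab, hq, dif_pos]
    have := (S.equivFin ⟨q, hq⟩).is_lt
    omega
  have hlab : Set.InjOn lab S := by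
    intro p hp q hq hpq
    rw [Finset.mem_coe] at hp hq
    simp only [lab, hp, hq, dif_pos, Nat.add_right_cancel_iff] at hpq
    have := S.equivFin.injective (Fin.ext hpq)
    simpa using this
  have hBpos : 0 < Fintype.card Γ := Fintype.card_pos
  refine ⟨Fintype.card Γ, S.card + 2, rulesOf M S lab g, hBpos, by omega, ?_, ?_⟩
  · intro r hr
    rcases mem_rulesOf.1 hr with rfl | ⟨q, hq, a, rfl⟩
    · exact ⟨le_rfl, by dsimp only; omega, by dsimp only; omega, hBpos, hlabK _ hS.1, hBpos⟩
    · have h1 := hlabK q hq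
      unfold ruleOf Rule.Bounded
      split
      · exact ⟨by dsimp only; omega, le_rfl, h1, hgB _, by dsimp only; omega, hgB _⟩
      · rename_i q' hM'
        exact ⟨by dsimp only; omega, by dsimp only; omega, h1, hgB _, hlabK _ (hS.2 hM' hq), hBpos⟩
      · rename_i q' hM'
        exact ⟨by dsimp only; omega, by dsimp only; omega, h1, hgB _, hlabK _ (hS.2 hM' hq), hBpos⟩
      · rename_i q' b hM'
        exact ⟨by dsimp only; omega, by dsimp only; omega, h1, hgB _, hlabK _ (hS.2 hM' hq), hgB _⟩
  · intro hcomp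
    obtain ⟨φ, hφ, hφ'⟩ := ComputablePred.computable_iff.1 hcomp
    apply hM
    rw [ComputablePred.computable_iff]
    refine ⟨_, hφ.comp (hf (Fintype.card Γ) g), ?_⟩
    funext n
    rw [← numHalts_iff hgB hgi hg hlab hlab2 hS, hφ']

/-! ### Turing machines as systems of linear constraints -/

section Linear

/-- A strict linear inequality between two consecutive vectors `x`, `y` of five numbers, imposed on
the steps whose type satisfies `types`. The type `none` is that of the virtual step from `x = 0` to
the initial vector. -/
structure Constraint where
  types : Option (Fin 5) → Bool
  a : Fin 5 → ℤ
  b : Fin 5 → ℤ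
  c : ℤ

/-- The linear form of a constraint, which is required to be negative. -/
def Constraint.value (κ : Constraint) (x y : Fin 5 → ℕ) : ℤ :=
  ∑ j, κ.a j * x j + ∑ j, κ.b j * y j + κ.c

/-- The constraint is respected by a step of type `t` from `x` to `y`. -/
def Constraint.Holds (κ : Constraint) (t : Option (Fin 5)) (x y : Fin 5 → ℕ) : Prop :=
  κ.types t = true → κ.value x y < 0

/-- Reachability of a vector with last entry `0`. -/
def LinHalts (cs : List Constraint) : Prop :=
  ∃ x y, (∀ κ ∈ cs, κ.Holds none 0 x) ∧
    Relation.ReflTransGen (fun x y => ∃ t, ∀ κ ∈ cs, κ.Holds (some t) x y) x y ∧ y 4 = 0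

/-- The rule as a number with the digits `kind`, `s`, `s'`, `u`, `u'` in the mixed radix
`4, B, B, K, K`. -/
def Rule.code (B K : ℕ) (r : Rule) : ℕ :=
  r.kind + 4 * (r.s + B * (r.s' + B * (r.u + K * r.u')))

theorem Rule.Bounded.code_lt {B K : ℕ} {r : Rule} (h : r.Bounded B K) :
    r.code B K < 4 * (B * (B * (K * K))) := by
  have key : ∀ {m a n x : ℕ}, a < m → x < n → a + m * x < m * n := by
    intro m a n x ha hx
    calc a + m * x < m + m * x := by omega
      _ = m * (x + 1) := by ring
      _ ≤ m * n := Nat.mul_le_mul_left _ hx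
  obtain ⟨-, h2, h3, h4, h5, h6⟩ := h
  exact key (by omega) (key h4 (key h6 (key h3 h5)))

theorem Rule.Bounded.code_pos {B K : ℕ} {r : Rule} (h : r.Bounded B K) : 0 < r.code B K := by
  have := h.1
  unfold Rule.code
  omega

theorem Rule.Bounded.code_inj {B K : ℕ} {r r' : Rule} (h : r.Bounded B K) (h' : r'.Bounded B K)
    (e : r.code B K = r'.code B K) : r = r' := by
  obtain ⟨k, u, s, v, t⟩ := r
  obtain ⟨k', u', s', v', t'⟩ := r'
  obtain ⟨-, h2, h3, h4, h5, h6⟩ := h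
  obtain ⟨-, h2', h3', h4', h5', h6'⟩ := h'
  dsimp only [Rule.code] at *
  obtain ⟨rfl, e1⟩ := digit_unique (by omega) (by omega) e
  obtain ⟨rfl, e2⟩ := digit_unique h4 h4' e1
  obtain ⟨rfl, e3⟩ := digit_unique h6 h6' e2
  obtain ⟨rfl, rfl⟩ := digit_unique h3 h3' e3
  rfl

/-- The constraint that the linear form is at most `0`. -/
def leCon (T : List (Option (Fin 5))) (a b : Fin 5 → ℤ) (c : ℤ) : Constraint :=
  ⟨fun t => decide (t ∈ T), a, b, c - 1⟩

/-- Two constraints saying that the linear form is `0`. -/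
def eqCon (T : List (Option (Fin 5))) (a b : Fin 5 → ℤ) (c : ℤ) : List Constraint :=
  [leCon T a b c, leCon T (fun i => -a i) (fun i => -b i) (-c)]

theorem leCon_holds {T : List (Option (Fin 5))} {a b : Fin 5 → ℤ} {c : ℤ} {t : Option (Fin 5)}
    {x y : Fin 5 → ℕ} :
    (leCon T a b c).Holds t x y ↔ (t ∈ T → ∑ j, a j * x j + ∑ j, b j * y j + c ≤ 0) := by
  simp only [leCon, Constraint.Holds, Constraint.value, decide_eq_true_eq]
  refine imp_congr_right fun _ => ?_
  omega

theorem eqCon_holds {T : List (Option (Fin 5))} {a b : Fin 5 → ℤ} {c : ℤ} {t : Option (Fin 5)}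
    {x y : Fin 5 → ℕ} :
    (∀ κ ∈ eqCon T a b c, κ.Holds t x y) ↔
      (t ∈ T → ∑ j, a j * x j + ∑ j, b j * y j + c = 0) := by
  simp only [eqCon, List.mem_cons, List.not_mem_nil, or_false, forall_eq_or_imp, forall_eq,
    leCon_holds, neg_mul, Finset.sum_neg_distrib]
  constructor
  · rintro ⟨h1, h2⟩ ht
    have := h1 ht
    have := h2 ht
    omega
  · intro h
    refine ⟨fun ht => ?_, fun ht => ?_⟩ <;> have := h ht <;> omega

/-- The constraints on the vectors `(P, s, L, R, u)`, where `(u, s, L, R)` is a configuration of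
a Turing machine in numbers and `P` is a list of rules in base `C`. The types of steps are:
`0`, drop the first rule of `P`; `1`, reset `P` to the full list `P₀`; `2`, `3` and `4`, drop the
first rule of `P` and apply it, as a move to the right, a move to the left, a writing step. -/
def machineConstraints (B K P₀ n : ℕ) : List Constraint :=
  let C : ℕ := 4 * (B * (B * (K * K)))
  [leCon [none, some 0, some 1, some 2, some 3, some 4] 0 ![0, 0, 0, 0, 1] (1 - K),
    leCon [none, some 0, some 1, some 2, some 3, some 4] 0 ![0, 1, 0, 0, 0] (1 - B),
    leCon [some 0] ![-1, 0, 0, 0, 0] ![C, 0, 0, 0, 0] 0,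
    leCon [some 0] ![1, 0, 0, 0, 0] ![-C, 0, 0, 0, 0] (1 - C)] ++
  (eqCon [none, some 1] 0 ![1, 0, 0, 0, 0] (-P₀) ++
  (eqCon [some 0, some 1] ![0, 0, 0, 0, -1] ![0, 0, 0, 0, 1] 0 ++
  (eqCon [some 0, some 1] ![0, -1, 0, 0, 0] ![0, 1, 0, 0, 0] 0 ++
  (eqCon [some 0, some 1, some 4] ![0, 0, -1, 0, 0] ![0, 0, 1, 0, 0] 0 ++
  (eqCon [some 0, some 1, some 4] ![0, 0, 0, -1, 0] ![0, 0, 0, 1, 0] 0 ++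
  (eqCon [some 2] ![1, -4, 0, 0, -(4 * B * B)] ![-C, 0, 0, 0, -(4 * B * B * K)] (-1) ++
  (eqCon [some 3] ![1, -4, 0, 0, -(4 * B * B)] ![-C, 0, 0, 0, -(4 * B * B * K)] (-2) ++
  (eqCon [some 4] ![1, -4, 0, 0, -(4 * B * B)] ![-C, -(4 * B), 0, 0, -(4 * B * B * K)] (-3) ++
  (eqCon [some 2] ![0, -1, -B, 0, 0] ![0, 0, 1, 0, 0] 0 ++
  (eqCon [some 2] ![0, 0, 0, 1, 0] ![0, -1, 0, -B, 0] 0 ++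
  (eqCon [some 3] ![0, -1, 0, -B, 0] ![0, 0, 0, 1, 0] 0 ++
  (eqCon [some 3] ![0, 0, 1, 0, 0] ![0, -1, -B, 0, 0] 0 ++
  (eqCon [none] 0 ![0, 0, 0, 0, 1] (-1) ++
  (eqCon [none] 0 ![0, 1, 0, 0, 0] 0 ++
  (eqCon [none] 0 ![0, 0, 1, 0, 0] 0 ++
  eqCon [none] 0 ![0, 0, 0, 1, 0] (-n))))))))))))))))

/-- The vector of a configuration. -/
def NumCfg.vec (c : NumCfg) (P : ℕ) : Fin 5 → ℕ := ![P, c.s, c.L, c.R, c.u]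

/-- The configuration read off a vector. -/
def numCfgOf (x : Fin 5 → ℕ) : NumCfg := ⟨x 4, x 1, x 2, x 3⟩

theorem numCfgOf_vec (x : Fin 5 → ℕ) : (numCfgOf x).vec (x 0) = x := by
  funext i; fin_cases i <;> rfl

/-- The arithmetic meaning of the constraints. -/
def NumLin (B K P₀ n : ℕ) : Option (Fin 5) → ℕ → NumCfg → ℕ → NumCfg → Prop
  | none, _, _, Q, d => Q = P₀ ∧ d = ⟨1, 0, 0, n⟩
  | some 0, P, c, Q, d => d = c ∧ 4 * (B * (B * (K * K))) * Q ≤ P ∧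
      P < 4 * (B * (B * (K * K))) * Q + 4 * (B * (B * (K * K)))
  | some 1, _, c, Q, d => d = c ∧ Q = P₀
  | some 2, P, c, Q, d => d.L = c.s + B * c.L ∧ c.R = d.s + B * d.R ∧
      P = Rule.code B K ⟨1, c.u, c.s, d.u, 0⟩ + 4 * (B * (B * (K * K))) * Q
  | some 3, P, c, Q, d => d.R = c.s + B * c.R ∧ c.L = d.s + B * d.L ∧
      P = Rule.code B K ⟨2, c.u, c.s, d.u, 0⟩ + 4 * (B * (B * (K * K))) * Q
  | some 4, P, c, Q, d => d.L = c.L ∧ c.R = d.R ∧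
      P = Rule.code B K ⟨3, c.u, c.s, d.u, d.s⟩ + 4 * (B * (B * (K * K))) * Q

theorem machineConstraints_iff (B K P₀ n : ℕ) (t : Option (Fin 5)) (P Q : ℕ) (c d : NumCfg) :
    (∀ κ ∈ machineConstraints B K P₀ n, κ.Holds t (c.vec P) (d.vec Q)) ↔
      d.u < K ∧ d.s < B ∧ NumLin B K P₀ n t P c Q d := by
  obtain ⟨u, s, L, R⟩ := c
  obtain ⟨u', s', L', R'⟩ := d
  simp only [machineConstraints, List.forall_mem_append, eqCon_holds, List.forall_mem_cons,
    leCon_holds, Fin.sum_univ_five, NumCfg.vec]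
  rcases t with _ | t
  · simp [NumLin]
    omega
  · fin_cases t
    · simp [NumLin, and_assoc]
      zify
      constructor <;> rintro ⟨h1, h2, h3, h4, h5, h6, h7, h8⟩ <;>
        refine ⟨?_, ?_, ?_, ?_, ?_, ?_, ?_, ?_⟩ <;> linarith
    · simp [NumLin]
      omega
    all_goals
      simp [NumLin, Rule.code, and_assoc]
      zify
      constructor <;> rintro ⟨h1, h2, h3, h4, h5⟩ <;>
        refine ⟨?_, ?_, ?_, ?_, ?_⟩ <;> linarith

/-- The constraints on the steps of a machine describe its runs: the halting state is reachable for
the constraints exactly when the machine halts. -/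
theorem linHalts_iff {B K : ℕ} {rules : List Rule} (hB : 0 < B) (hK : 1 < K)
    (hr : ∀ r ∈ rules, r.Bounded B K) (n : ℕ) :
    LinHalts (machineConstraints B K
      (Nat.ofDigits (4 * (B * (B * (K * K)))) (rules.map (Rule.code B K))) n) ↔
      NumHalts B rules n := by
  set C := 4 * (B * (B * (K * K))) with hC
  set codes := rules.map (Rule.code B K) with hcodes
  have hlt : ∀ e ∈ codes, e < C ∧ 0 < e := by
    intro e he
    obtain ⟨r, hrr, rfl⟩ := List.mem_map.1 he
    exact ⟨(hr r hrr).code_lt, (hr r hrr).code_pos⟩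
  have hK0 : 0 < K := by omega
  constructor
  · rintro ⟨x, y, hx, hxy, hy⟩
    -- `P` is always a final segment of the list of rules
    have inv : (numCfgOf y).u < K ∧ (numCfgOf y).s < B ∧
        (∃ l, l <:+ codes ∧ y 0 = Nat.ofDigits C l) ∧
        Relation.ReflTransGen (NumStep B rules) ⟨1, 0, 0, n⟩ (numCfgOf y) := by
      clear hy
      induction hxy with
      | refl =>
        have h0 : (0 : Fin 5 → ℕ) = NumCfg.vec ⟨0, 0, 0, 0⟩ 0 := by
          funext i; fin_cases i <;> rfl
        rw [h0, ← numCfgOf_vec x, machineConstraints_iff] at hx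
        obtain ⟨h1, h2, h3, h4⟩ := hx
        exact ⟨h1, h2, ⟨codes, List.suffix_rfl, h3⟩, by rw [h4]⟩
      | @tail x y _ h ih =>
        obtain ⟨i1, i2, ⟨l, hl, hP⟩, i4⟩ := ih
        obtain ⟨t, ht⟩ := h
        rw [← numCfgOf_vec x, ← numCfgOf_vec y, machineConstraints_iff] at ht
        obtain ⟨j1, j2, ht⟩ := ht
        have apply_rule : ∀ r : Rule, r.Bounded B K → x 0 = r.code B K + C * y 0 →
            r.Applies B (numCfgOf x) (numCfgOf y) → (∃ l, l <:+ codes ∧ y 0 = Nat.ofDigits C l) ∧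
            Relation.ReflTransGen (NumStep B rules) ⟨1, 0, 0, n⟩ (numCfgOf y) := by
          intro r hrb hx0 happ
          rw [hP] at hx0
          cases l with
          | nil =>
            have := hrb.code_pos
            simp at hx0
            omega
          | cons e l =>
            rw [Nat.ofDigits_cons] at hx0
            have he := hl.subset (List.mem_cons_self)
            obtain ⟨e1, e2⟩ := digit_unique (hlt e he).1 hrb.code_lt hx0
            refine ⟨⟨l, (List.suffix_cons _ _).trans hl, e2.symm⟩, i4.tail ⟨r, ?_, happ⟩⟩
            obtain ⟨r', hr', rfl⟩ := List.mem_map.1 he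
            rwa [← (hr r' hr').code_inj hrb e1]
        refine ⟨j1, j2, ?_⟩
        fin_cases t
        · obtain ⟨h1, h2, h3⟩ := ht
          replace h2 : C * y 0 ≤ x 0 := h2
          replace h3 : x 0 < C * y 0 + C := h3
          rw [h1]
          refine ⟨?_, i4⟩
          rw [hP] at h2 h3
          cases l with
          | nil =>
            refine ⟨[], hl, ?_⟩
            simp only [Nat.ofDigits_nil] at h2 ⊢
            have hCpos : 0 < C := by positivity
            exact (Nat.mul_eq_zero.1 (Nat.le_zero.1 h2)).resolve_left hCpos.ne'
          | cons e l =>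
            refine ⟨l, (List.suffix_cons _ _).trans hl, ?_⟩
            rw [Nat.ofDigits_cons] at h2 h3
            have he := (hlt e (hl.subset (List.mem_cons_self))).1
            have h4 : e + C * Nat.ofDigits C l =
                (e + C * Nat.ofDigits C l - C * y 0) + C * y 0 := (Nat.sub_add_cancel h2).symm
            exact (digit_unique he (by omega) h4).2.symm
        · obtain ⟨h1, h2⟩ := ht
          rw [h1]
          exact ⟨⟨codes, List.suffix_rfl, h2⟩, i4⟩
        · obtain ⟨h1, h2, h3⟩ := ht
          exact apply_rule _ ⟨le_rfl, by simp, i1, i2, j1, hB⟩ h3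
            ⟨rfl, rfl, rfl, Or.inl ⟨rfl, rfl, j2, h1, h2⟩⟩
        · obtain ⟨h1, h2, h3⟩ := ht
          exact apply_rule _ ⟨by simp, by simp, i1, i2, j1, hB⟩ h3
            ⟨rfl, rfl, rfl, Or.inr (Or.inl ⟨rfl, rfl, j2, h1, h2⟩)⟩
        · obtain ⟨h1, h2, h3⟩ := ht
          exact apply_rule _ ⟨by simp, by simp, i1, i2, j1, j2⟩ h3
            ⟨rfl, rfl, rfl, Or.inr (Or.inr ⟨rfl, rfl, h1, h2.symm⟩)⟩
    exact ⟨_, inv.2.2.2, hy⟩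
  · rintro ⟨d, hd, hd0⟩
    set P₀ := Nat.ofDigits C codes with hP₀
    let R : (Fin 5 → ℕ) → (Fin 5 → ℕ) → Prop := fun x y =>
      ∃ t, ∀ κ ∈ machineConstraints B K P₀ n, κ.Holds (some t) x y
    have hR : ∀ t P c Q d, d.u < K → d.s < B → NumLin B K P₀ n (some t) P c Q d →
        R (c.vec P) (d.vec Q) := fun t P c Q d h1 h2 h3 =>
      ⟨t, (machineConstraints_iff B K P₀ n (some t) P Q c d).2 ⟨h1, h2, h3⟩⟩
    have skip : ∀ c : NumCfg, c.u < K → c.s < B → ∀ l, l <:+ codes →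
        Relation.ReflTransGen R (c.vec P₀) (c.vec (Nat.ofDigits C l)) := by
      intro c h1 h2 l hl
      obtain ⟨l', hl'⟩ := hl
      induction l' using List.reverseRecOn generalizing l with
      | nil => rw [← hl'] at hP₀; rw [hP₀]; rfl
      | append_singleton l' e ih =>
        refine (ih (e :: l) (by simpa using hl')).tail (hR 0 _ _ _ _ h1 h2 ⟨rfl, ?_, ?_⟩)
        · rw [Nat.ofDigits_cons, ← hC]; simp
        · have he := (hlt e (by rw [← hl']; simp)).1
          rw [Nat.ofDigits_cons, ← hC]
          omega
    have inv : d.u < K ∧ d.s < B ∧ ∃ P, Relation.ReflTransGen R (NumCfg.vec ⟨1, 0, 0, n⟩ P₀)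
        (d.vec P) := by
      clear hd0
      induction hd with
      | refl => exact ⟨hK, hB, P₀, Relation.ReflTransGen.refl⟩
      | @tail c d _ h ih =>
        obtain ⟨i1, i2, P, hP⟩ := ih
        obtain ⟨r, hrr, a1, a2, a3, a4⟩ := h
        obtain ⟨k, u, s, u', s'⟩ := r
        obtain ⟨b1, b2, b3, b4, b5, b6⟩ := hr _ hrr
        dsimp only at a1 a2 a3 a4 b1 b2 b3 b4 b5 b6
        have hdu : d.u < K := by omega
        have hds : d.s < B := by
          rcases a4 with ⟨-, -, h, -⟩ | ⟨-, -, h, -⟩ | ⟨-, h, -⟩ <;> omega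
        obtain ⟨l₁, l₂, hl⟩ := List.append_of_mem (List.mem_map_of_mem (f := Rule.code B K) hrr)
        have reset : Relation.ReflTransGen R (NumCfg.vec ⟨1, 0, 0, n⟩ P₀) (c.vec P₀) :=
          hP.tail (hR 1 _ _ _ _ i1 i2 ⟨rfl, rfl⟩)
        have found := reset.trans (skip c i1 i2 (Rule.code B K ⟨k, u, s, u', s'⟩ :: l₂)
          ⟨l₁, hl.symm⟩)
        refine ⟨hdu, hds, Nat.ofDigits C l₂, found.tail ?_⟩
        rw [Nat.ofDigits_cons]
        subst a1 a2 a3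
        rcases a4 with ⟨rfl, rfl, -, h1, h2⟩ | ⟨rfl, rfl, -, h1, h2⟩ | ⟨rfl, rfl, h1, h2⟩
        · exact hR 2 _ _ _ _ hdu hds ⟨h1, h2, rfl⟩
        · exact hR 3 _ _ _ _ hdu hds ⟨h1, h2, rfl⟩
        · exact hR 4 _ _ _ _ hdu hds ⟨h1, h2.symm, rfl⟩
    obtain ⟨-, -, P, hP⟩ := inv
    refine ⟨_, _, ?_, hP, hd0⟩
    have h0 : (0 : Fin 5 → ℕ) = NumCfg.vec ⟨0, 0, 0, 0⟩ 0 := by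
      funext i; fin_cases i <;> rfl
    rw [h0, machineConstraints_iff]
    exact ⟨hK, hB, rfl, rfl⟩

end Linear

/-! ### An automaton that checks linear constraints -/

section Checker

/-- The states of the automaton checking `m` constraints. A state `inl (i, h, j)` evaluates the
constraint `i` and has reached the entry `j` of the first (`h = false`) or of the second
(`h = true`) of two consecutive vectors. The states `inr 0, …, inr 5` follow the format of the
word, `inr 5` being reached inside a nonzero last entry; `inr 6` is reached when a constraint has
been evaluated; `inr 7` is isolated, and the states from `inr 8` on are not used. -/
abbrev CheckState (m : ℕ) : Type := (Fin m × Bool × Fin 5) ⊕ Fin 14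

variable {m : ℕ} (κ : Fin m → Constraint)

/-- The moves of the checking automaton. The letter `none` counts one unit of an entry and the
letters `some t` end an entry. The last letter `some t` of a vector gives the type of the step to
the next vector. -/
def checkMove : Option (Fin 5) → CheckState m → Option (CheckState m × ℤ)
  | none, .inl (i, false, j) => some (.inl (i, false, j), (κ i).a j)
  | none, .inl (i, true, j) => some (.inl (i, true, j), (κ i).b j)
  | some _, .inl (i, h, 0) => some (.inl (i, h, 1), 0)
  | some _, .inl (i, h, 1) => some (.inl (i, h, 2), 0)
  | some _, .inl (i, h, 2) => some (.inl (i, h, 3), 0)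
  | some _, .inl (i, h, 3) => some (.inl (i, h, 4), 0)
  | some t, .inl (i, false, 4) =>
    if (κ i).types (some t) then some (.inl (i, true, 0), 0) else none
  | some _, .inl (i, true, 4) => some (.inr 6, (κ i).c)
  | none, .inr 0 => some (.inr 0, 0)
  | none, .inr 1 => some (.inr 1, 0)
  | none, .inr 2 => some (.inr 2, 0)
  | none, .inr 3 => some (.inr 3, 0)
  | none, .inr 4 => some (.inr 5, 0)
  | none, .inr 5 => some (.inr 5, 0)
  | some _, .inr 0 => some (.inr 1, 0)
  | some _, .inr 1 => some (.inr 2, 0)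
  | some _, .inr 2 => some (.inr 3, 0)
  | some _, .inr 3 => some (.inr 4, 0)
  | some _, .inr 5 => some (.inr 0, 0)
  | _, .inr 6 => some (.inr 6, 0)
  | none, .inr 7 => some (.inr 7, 0)
  | some t, .inr 7 => some (.inr 7, (t : ℕ) + 1)
  | _, .inr _ => none

/-- At the end of a vector with nonzero last entry, the evaluation of any constraint can start. -/
def checkFork : Option (Fin 5) → CheckState m → CheckState m → Bool
  | some _, .inr 5, .inl (_, false, 0) => true
  | _, _, _ => false

/-- The weights of the checking automaton. They extend the deterministic moves by forks of weight
`0`. -/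
def checkWt (a : Option (Fin 5)) (p q : CheckState m) : ZMax :=
  if checkFork a p q then 0 else
    match checkMove κ a p with
    | some (r, z) => if r = q then (z : ZMax) else ⊥
    | none => ⊥

/-- The automaton in which the words without nonnegative path are those that describe a run,
respecting the constraints, to a vector with last entry `0`. -/
def checker : MaxPlusAut (Option (Fin 5)) (CheckState m) where
  wt := checkWt κ
  init := fun
    | .inl (_, false, 0) => true
    | .inl (i, true, 0) => (κ i).types none
    | .inr 0 => true
    | _ => false
  fin := fun
    | .inr 0 | .inr 1 | .inr 2 | .inr 3 | .inr 4 | .inr 5 | .inr 6 => true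
    | _ => false

theorem checkWt_eq_iff {a : Option (Fin 5)} {p q : CheckState m} {z : ℤ} :
    checkWt κ a p q = (z : ZMax) ↔
      (checkFork a p q = true ∧ z = 0) ∨ (checkMove κ a p = some (q, z)) := by
  unfold checkWt
  split_ifs with h
  · have hm : checkMove κ a p ≠ some (q, z) := by
      intro h2
      unfold checkFork at h
      split at h
      · simp [checkMove] at h2
      · exact absurd h (by simp)
    simp only [h, true_and, hm, or_false]
    constructor
    · intro h2
      have h3 : ((0 : ℤ) : ZMax) = (z : ZMax) := h2
      exact (WithBot.coe_injective h3).symm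
    · rintro rfl; rfl
  · simp only [h, Bool.false_eq_true, false_and, false_or]
    rcases checkMove κ a p with _ | ⟨r, y⟩
    · simp
    · by_cases hr : r = q
      · simp [hr]
      · simp [hr]

/-- The letters that describe one entry `n` of a vector. -/
def entryWord (n : ℕ) (t : Fin 5) : List (Option (Fin 5)) := List.replicate n none ++ [some t]

variable {κ}

theorem path_cons_of_no_fork {a : Option (Fin 5)} {w : List (Option (Fin 5))}
    {p q : CheckState m} {z : ℤ} (hp : p ≠ .inr 5) :
    Path (checkWt κ) (a :: w) p q z ↔
      ∃ r x, checkMove κ a p = some (r, x) ∧ Path (checkWt κ) w r q (z - x) := by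
  have hf : ∀ r, checkFork a p r = false := by
    intro r
    unfold checkFork
    split
    · exact absurd rfl hp
    · rfl
  simp only [Path, checkWt_eq_iff, hf, Bool.false_eq_true, false_and, false_or]
  constructor
  · rintro ⟨r, x, y, h1, h2, rfl⟩
    exact ⟨r, x, h1, by simpa using h2⟩
  · rintro ⟨r, x, h1, h2⟩
    exact ⟨r, x, z - x, h1, h2, by ring⟩

theorem path_replicate_append {p q : CheckState m} {c : ℤ} (hp : checkMove κ none p = some (p, c))
    (n : ℕ) (w : List (Option (Fin 5))) (z : ℤ) :
    Path (checkWt κ) (List.replicate n none ++ w) p q z ↔ Path (checkWt κ) w p q (z - c * n) := by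
  induction n generalizing z with
  | zero => simp
  | succ n ih =>
    have hloop : ∀ r x, checkWt κ none p r = ((x : ℤ) : ZMax) ↔ r = p ∧ x = c := by
      intro r x
      have : checkFork none p r = false := rfl
      rw [checkWt_eq_iff, this, hp]
      simp [eq_comm]
    rw [List.replicate_succ, List.cons_append]
    simp only [Path, hloop]
    constructor
    · rintro ⟨r, x, y, ⟨rfl, rfl⟩, h, rfl⟩
      rw [ih] at h
      convert h using 1
      push_cast; ring
    · intro h
      refine ⟨p, c, z - c, ⟨rfl, rfl⟩, ?_, by ring⟩
      rw [ih]
      convert h using 1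
      push_cast; ring

theorem path_entry {p q : CheckState m} {c : ℤ} (hp : checkMove κ none p = some (p, c))
    (h5 : p ≠ .inr 5) (n : ℕ) (t : Fin 5) (w : List (Option (Fin 5))) (z : ℤ) :
    Path (checkWt κ) (entryWord n t ++ w) p q z ↔
      ∃ r x, checkMove κ (some t) p = some (r, x) ∧
        Path (checkWt κ) w r q (z - c * n - x) := by
  rw [entryWord, List.append_assoc, path_replicate_append hp, List.singleton_append,
    path_cons_of_no_fork h5]

theorem path_done {w : List (Option (Fin 5))} {q : CheckState m} {z : ℤ} :
    Path (checkWt κ) w (.inr 6) q z ↔ q = .inr 6 ∧ z = 0 := by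
  induction w generalizing z with
  | nil => simp [Path, eq_comm]
  | cons a w ih =>
    rw [path_cons_of_no_fork (by simp)]
    have : checkMove κ a (.inr 6) = some (.inr 6, 0) := by cases a <;> rfl
    simp [this, ih]

theorem path_entry_last {q : CheckState m} (n : ℕ) (t : Fin 5) (w : List (Option (Fin 5)))
    (z : ℤ) :
    Path (checkWt κ) (entryWord n t ++ w) (.inr 4) q z ↔
      n ≠ 0 ∧ (Path (checkWt κ) w (.inr 0) q z ∨
        ∃ i, Path (checkWt κ) w (.inl (i, false, 0)) q z) := by
  cases n with
  | zero =>
    rw [entryWord, List.replicate_zero, List.nil_append, List.singleton_append,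
      path_cons_of_no_fork (by simp)]
    have : checkMove κ (some t) (.inr 4) = none := rfl
    simp [this]
  | succ n =>
    have h1 : checkMove κ none (.inr 4) = some (.inr 5, 0) := rfl
    have h2 : checkMove κ none (.inr 5) = some (.inr 5, 0) := rfl
    have h3 : checkMove κ (some t) (.inr 5) = some (.inr 0, 0) := rfl
    have h0 : ∀ w z, Path (checkWt κ) (none :: w) (.inr 4) q z ↔
        Path (checkWt κ) w (.inr 5) q z := by
      intro w z
      rw [path_cons_of_no_fork (by simp)]
      simp [h1]
    rw [entryWord, List.replicate_succ, List.cons_append, List.cons_append, h0,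
      List.append_assoc, path_replicate_append h2, List.singleton_append]
    simp only [Path, checkWt_eq_iff, h3, Option.some.injEq, Prod.mk.injEq]
    have hfork : ∀ r, checkFork (some t) (.inr 5) r = true ↔
        ∃ i : Fin m, r = .inl (i, false, 0) := by
      intro r
      unfold checkFork
      split <;> simp_all
    simp only [hfork]
    constructor
    · rintro ⟨r, x, y, ⟨⟨i, rfl⟩, rfl⟩ | ⟨rfl, rfl⟩, h, hz⟩
      · refine ⟨by simp, Or.inr ⟨i, ?_⟩⟩
        convert h using 1; linarith
      · refine ⟨by simp, Or.inl ?_⟩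
        convert h using 1; linarith
    · rintro ⟨-, h | ⟨i, h⟩⟩
      · exact ⟨_, 0, z, Or.inr ⟨rfl, rfl⟩, h, by ring⟩
      · exact ⟨_, 0, z, Or.inl ⟨⟨i, rfl⟩, rfl⟩, h, by ring⟩

/-- The word `w` preceded by the letters that describe a vector. Among the types `t` only the last
one matters. -/
def vectorWord (x : Fin 5 → ℕ) (t : Fin 5 → Fin 5) (w : List (Option (Fin 5))) :
    List (Option (Fin 5)) :=
  entryWord (x 0) (t 0) ++ (entryWord (x 1) (t 1) ++ (entryWord (x 2) (t 2) ++
    (entryWord (x 3) (t 3) ++ (entryWord (x 4) (t 4) ++ w))))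

theorem path_entry_fmt {j k : Fin 14} (h0 : checkMove κ none (.inr j) = some (.inr j, 0))
    (h1 : ∀ t, checkMove κ (some t) (.inr j) = some (.inr k, 0)) (hj : j ≠ 5) (n : ℕ)
    (t : Fin 5) (w : List (Option (Fin 5))) (q : CheckState m) (z : ℤ) :
    Path (checkWt κ) (entryWord n t ++ w) (.inr j) q z ↔ Path (checkWt κ) w (.inr k) q z := by
  rw [path_entry h0 (by simpa using hj)]
  simp [h1]

theorem path_vectorWord_fmt (x : Fin 5 → ℕ) (t : Fin 5 → Fin 5) (w : List (Option (Fin 5)))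
    (q : CheckState m) (z : ℤ) :
    Path (checkWt κ) (vectorWord x t w) (.inr 0) q z ↔
      x 4 ≠ 0 ∧ (Path (checkWt κ) w (.inr 0) q z ∨
        ∃ i, Path (checkWt κ) w (.inl (i, false, 0)) q z) := by
  rw [vectorWord, path_entry_fmt (k := 1) rfl (fun _ => rfl) (by decide),
    path_entry_fmt (k := 2) rfl (fun _ => rfl) (by decide),
    path_entry_fmt (k := 3) rfl (fun _ => rfl) (by decide),
    path_entry_fmt (k := 4) rfl (fun _ => rfl) (by decide), path_entry_last]

theorem path_entry_inl {i : Fin m} {h : Bool} {j k : Fin 5} {c : ℤ}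
    (h0 : checkMove κ none (.inl (i, h, j)) = some (.inl (i, h, j), c))
    (h1 : ∀ t, checkMove κ (some t) (.inl (i, h, j)) = some (.inl (i, h, k), 0)) (n : ℕ)
    (t : Fin 5) (w : List (Option (Fin 5))) (q : CheckState m) (z : ℤ) :
    Path (checkWt κ) (entryWord n t ++ w) (.inl (i, h, j)) q z ↔
      Path (checkWt κ) w (.inl (i, h, k)) q (z - c * n) := by
  rw [path_entry h0 (by simp)]
  simp [h1]

theorem path_vectorWord_fst (x : Fin 5 → ℕ) (t : Fin 5 → Fin 5) (w : List (Option (Fin 5)))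
    (i : Fin m) (q : CheckState m) (z : ℤ) :
    Path (checkWt κ) (vectorWord x t w) (.inl (i, false, 0)) q z ↔
      (κ i).types (some (t 4)) = true ∧
        Path (checkWt κ) w (.inl (i, true, 0)) q (z - ∑ j, (κ i).a j * x j) := by
  rw [vectorWord, path_entry_inl (k := 1) rfl (fun _ => rfl),
    path_entry_inl (k := 2) rfl (fun _ => rfl), path_entry_inl (k := 3) rfl (fun _ => rfl),
    path_entry_inl (k := 4) rfl (fun _ => rfl), path_entry rfl (by simp)]
  have h1 : checkMove κ (some (t 4)) (.inl (i, false, 4)) =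
    if (κ i).types (some (t 4)) then some (.inl (i, true, 0), 0) else none := rfl
  rw [h1, Fin.sum_univ_five]
  by_cases ht : (κ i).types (some (t 4)) = true
  · simp only [ht, if_true, Option.some.injEq, Prod.mk.injEq, true_and]
    constructor
    · rintro ⟨r, y, ⟨rfl, rfl⟩, h⟩
      convert h using 1; ring
    · intro h
      refine ⟨_, _, ⟨rfl, rfl⟩, ?_⟩
      convert h using 1; ring
  · simp [ht]

theorem path_vectorWord_snd (x : Fin 5 → ℕ) (t : Fin 5 → Fin 5) (w : List (Option (Fin 5)))
    (i : Fin m) (q : CheckState m) (z : ℤ) :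
    Path (checkWt κ) (vectorWord x t w) (.inl (i, true, 0)) q z ↔
      q = .inr 6 ∧ z = ∑ j, (κ i).b j * x j + (κ i).c := by
  rw [vectorWord, path_entry_inl (k := 1) rfl (fun _ => rfl),
    path_entry_inl (k := 2) rfl (fun _ => rfl), path_entry_inl (k := 3) rfl (fun _ => rfl),
    path_entry_inl (k := 4) rfl (fun _ => rfl), path_entry rfl (by simp)]
  have h1 : checkMove κ (some (t 4)) (.inl (i, true, 4)) = some (.inr 6, (κ i).c) := rfl
  rw [h1, Fin.sum_univ_five]
  simp only [Option.some.injEq, Prod.mk.injEq]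
  constructor
  · rintro ⟨r, y, ⟨rfl, rfl⟩, h⟩
    obtain ⟨h2, h3⟩ := path_done.1 h
    exact ⟨h2, by linarith⟩
  · rintro ⟨rfl, rfl⟩
    exact ⟨_, _, ⟨rfl, rfl⟩, path_done.2 ⟨rfl, by ring⟩⟩

theorem entryWord_split (w : List (Option (Fin 5))) :
    (∃ n, w = List.replicate n none) ∨ ∃ n t w', w = entryWord n t ++ w' := by
  induction w with
  | nil => exact Or.inl ⟨0, rfl⟩
  | cons a w ih =>
    rcases a with _ | t
    · rcases ih with ⟨n, rfl⟩ | ⟨n, t, w', rfl⟩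
      · exact Or.inl ⟨n + 1, rfl⟩
      · exact Or.inr ⟨n + 1, t, w', rfl⟩
    · exact Or.inr ⟨0, t, w, rfl⟩

/-- A word either begins with the description of a vector, or is too short and is then accepted by
the states that follow the format. -/
theorem vectorWord_split (κ : Fin m → Constraint) (w : List (Option (Fin 5))) :
    (∃ x t w', w = vectorWord x t w') ∨
      ∃ q, (checker κ).fin q = true ∧ Path (checkWt κ) w (.inr 0) q 0 := by
  have loop : ∀ (j : Fin 14) (n : ℕ), checkMove κ none (.inr j) = some (.inr j, 0) →
      Path (checkWt κ) (List.replicate n none) (.inr j) (.inr j) 0 := by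
    intro j n h
    have := (path_replicate_append (q := .inr j) h n [] 0).2 (by simp [Path])
    simpa using this
  rcases entryWord_split w with ⟨n, rfl⟩ | ⟨n0, t0, w, rfl⟩
  · exact Or.inr ⟨.inr 0, rfl, loop 0 n rfl⟩
  rcases entryWord_split w with ⟨n, rfl⟩ | ⟨n1, t1, w, rfl⟩
  · refine Or.inr ⟨.inr 1, rfl, ?_⟩
    rw [path_entry_fmt (k := 1) rfl (fun _ => rfl) (by decide)]
    exact loop 1 n rfl
  rcases entryWord_split w with ⟨n, rfl⟩ | ⟨n2, t2, w, rfl⟩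
  · refine Or.inr ⟨.inr 2, rfl, ?_⟩
    rw [path_entry_fmt (k := 1) rfl (fun _ => rfl) (by decide),
      path_entry_fmt (k := 2) rfl (fun _ => rfl) (by decide)]
    exact loop 2 n rfl
  rcases entryWord_split w with ⟨n, rfl⟩ | ⟨n3, t3, w, rfl⟩
  · refine Or.inr ⟨.inr 3, rfl, ?_⟩
    rw [path_entry_fmt (k := 1) rfl (fun _ => rfl) (by decide),
      path_entry_fmt (k := 2) rfl (fun _ => rfl) (by decide),
      path_entry_fmt (k := 3) rfl (fun _ => rfl) (by decide)]
    exact loop 3 n rfl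
  rcases entryWord_split w with ⟨n, rfl⟩ | ⟨n4, t4, w, rfl⟩
  · have h4 : ∃ q, (checker κ).fin q = true ∧
        Path (checkWt κ) (List.replicate n none) (.inr 4) q 0 := by
      cases n with
      | zero => exact ⟨.inr 4, rfl, rfl, rfl⟩
      | succ n =>
        refine ⟨.inr 5, rfl, ?_⟩
        rw [List.replicate_succ, path_cons_of_no_fork (by simp)]
        exact ⟨.inr 5, 0, rfl, by simpa using loop 5 n rfl⟩
    obtain ⟨q, hq, hp⟩ := h4
    refine Or.inr ⟨q, hq, ?_⟩
    rw [path_entry_fmt (k := 1) rfl (fun _ => rfl) (by decide),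
      path_entry_fmt (k := 2) rfl (fun _ => rfl) (by decide),
      path_entry_fmt (k := 3) rfl (fun _ => rfl) (by decide),
      path_entry_fmt (k := 4) rfl (fun _ => rfl) (by decide)]
    exact hp
  · exact Or.inl ⟨![n0, n1, n2, n3, n4], ![t0, t1, t2, t3, t4], w, rfl⟩

/-- A run that respects the constraints gives a word all of whose paths are negative. -/
theorem exists_word_of_linHalts (h : ∃ x y, (∀ i, (κ i).Holds none 0 x) ∧
    Relation.ReflTransGen (fun x y => ∃ t, ∀ i, (κ i).Holds (some t) x y) x y ∧ y 4 = 0) :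
    ∃ w, ¬ (checker κ).Nonneg w := by
  obtain ⟨x, y, hx, hxy, hy⟩ := h
  have key : ∃ w : List (Option (Fin 5)), ∀ q z, (checker κ).fin q = true →
      (Path (checkWt κ) w (.inr 0) q z → z < 0) ∧
      (∀ i, Path (checkWt κ) w (.inl (i, false, 0)) q z → z < 0) ∧
      (∀ i, Path (checkWt κ) w (.inl (i, true, 0)) q z →
        z = ∑ j, (κ i).b j * x j + (κ i).c) := by
    clear hx
    induction hxy using Relation.ReflTransGen.head_induction_on with
    | refl =>
      refine ⟨vectorWord y (fun _ => 0) [], fun q z hq => ⟨?_, ?_, ?_⟩⟩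
      · rw [path_vectorWord_fmt]
        exact fun h => absurd hy h.1
      · intro i
        rw [path_vectorWord_fst]
        rintro ⟨-, rfl, -⟩
        exact absurd hq (by simp [checker])
      · intro i
        rw [path_vectorWord_snd]
        exact fun h => h.2
    | @head x x' hstep _ ih =>
      obtain ⟨t, ht⟩ := hstep
      obtain ⟨w, hw⟩ := ih
      refine ⟨vectorWord x (fun _ => t) w, fun q z hq => ⟨?_, ?_, ?_⟩⟩
      · rw [path_vectorWord_fmt]
        rintro ⟨-, h | ⟨i, h⟩⟩
        · exact (hw q z hq).1 h
        · exact (hw q z hq).2.1 i h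
      · intro i
        rw [path_vectorWord_fst]
        rintro ⟨h1, h2⟩
        have h3 := (hw q _ hq).2.2 i h2
        have h4 := ht i h1
        unfold Constraint.value at h4
        linarith
      · intro i
        rw [path_vectorWord_snd]
        exact fun h => h.2
  obtain ⟨w, hw⟩ := key
  refine ⟨w, ?_⟩
  rintro ⟨p, q, z, hp, hq, hpath, hz⟩
  have h1 := hw q z hq
  rcases p with ⟨i, h, j⟩ | j
  · cases h
    · fin_cases j
      · exact absurd (h1.2.1 i hpath) (not_lt.2 hz)
      all_goals exact absurd hp (by simp [checker])
    · fin_cases j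
      · have h2 := hx i hp
        have h3 := h1.2.2 i hpath
        unfold Constraint.value at h2
        simp only [Pi.zero_apply, Nat.cast_zero, mul_zero, Finset.sum_const_zero, zero_add] at h2
        linarith
      all_goals exact absurd hp (by simp [checker])
  · fin_cases j
    · exact absurd (h1.1 hpath) (not_lt.2 hz)
    all_goals exact absurd hp (by simp [checker])

/-- A word all of whose paths are negative describes a run that respects the constraints. -/
theorem linHalts_of_word (n : ℕ) : ∀ (w : List (Option (Fin 5))) (x₀ : Fin 5 → ℕ)
    (t₀ : Option (Fin 5)), w.length ≤ n →
    (∀ q z, (checker κ).fin q = true → Path (checkWt κ) w (.inr 0) q z → z < 0) →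
    (∀ i q z, (checker κ).fin q = true →
      Path (checkWt κ) w (.inl (i, false, 0)) q z → z < 0) →
    (∀ i q z, (checker κ).fin q = true → (κ i).types t₀ = true →
      Path (checkWt κ) w (.inl (i, true, 0)) q z → ∑ j, (κ i).a j * x₀ j + z < 0) →
    ∃ x y, (∀ i, (κ i).Holds t₀ x₀ x) ∧
      Relation.ReflTransGen (fun x y => ∃ t, ∀ i, (κ i).Holds (some t) x y) x y ∧ y 4 = 0 := by
  induction n with
  | zero =>
    intro w x₀ t₀ hw h1
    obtain rfl : w = [] := List.eq_nil_of_length_eq_zero (by omega)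
    exact absurd (h1 (.inr 0) 0 rfl ⟨rfl, rfl⟩) (lt_irrefl _)
  | succ n ih =>
    intro w x₀ t₀ hw h1 h2 h3
    rcases vectorWord_split κ w with ⟨x, t, w, rfl⟩ | ⟨q, hq, hp⟩
    · have hx : ∀ i, (κ i).Holds t₀ x₀ x := by
        intro i hi
        have := h3 i (.inr 6) _ rfl hi ((path_vectorWord_snd x t w i _ _).2 ⟨rfl, rfl⟩)
        unfold Constraint.value
        linarith
      by_cases hx4 : x 4 = 0
      · exact ⟨x, x, hx, Relation.ReflTransGen.refl, hx4⟩
      · obtain ⟨x', y, hx', hxy, hy⟩ := ih w x (some (t 4))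
          (by simp [vectorWord, entryWord] at hw; omega)
          (fun q z hq hp => h1 q z hq
            ((path_vectorWord_fmt x t w q z).2 ⟨hx4, Or.inl hp⟩))
          (fun i q z hq hp => h1 q z hq
            ((path_vectorWord_fmt x t w q z).2 ⟨hx4, Or.inr ⟨i, hp⟩⟩))
          (fun i q z hq hi hp => h2 i q _ hq
            ((path_vectorWord_fst x t w i q _).2 ⟨hi, by convert hp using 1; ring⟩))
        exact ⟨x, y, hx, Relation.ReflTransGen.head ⟨t 4, hx'⟩ hxy, hy⟩
    · exact absurd (h1 q 0 hq hp) (lt_irrefl _)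

theorem exists_word_iff : (∃ w, ¬ (checker κ).Nonneg w) ↔
    ∃ x y, (∀ i, (κ i).Holds none 0 x) ∧
      Relation.ReflTransGen (fun x y => ∃ t, ∀ i, (κ i).Holds (some t) x y) x y ∧ y 4 = 0 := by
  refine ⟨?_, exists_word_of_linHalts⟩
  rintro ⟨w, hw⟩
  have neg : ∀ p q z, (checker κ).init p = true → (checker κ).fin q = true →
      Path (checkWt κ) w p q z → z < 0 := by
    intro p q z hp hq hpath
    by_contra hz
    exact hw ⟨p, q, z, hp, hq, hpath, not_lt.1 hz⟩
  refine linHalts_of_word _ w 0 none le_rfl (fun q z hq => neg _ q z rfl hq)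
    (fun i q z hq => neg _ q z rfl hq) (fun i q z hq hi hp => ?_)
  have := neg (.inl (i, true, 0)) q z hi hq hp
  simpa using this

end Checker

/-! ### A family of automata whose weights are affine in the input -/

/-- A family of automata whose weights are affine functions of a parameter. -/
structure AffineAut (A σ : Type) where
  base : A → σ → σ → ZMax
  slope : A → σ → σ → ℤ
  init : σ → Bool
  fin : σ → Bool

/-- The automaton of the family for the value `n` of the parameter. -/
def AffineAut.eval {A σ : Type} (𝒰 : AffineAut A σ) (n : ℕ) : MaxPlusAut A σ where
  wt a p q := 𝒰.base a p q + ((𝒰.slope a p q * n : ℤ) : ZMax)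
  init := 𝒰.init
  fin := 𝒰.fin

theorem eval_wt_iff {A σ : Type} {𝒰 : AffineAut A σ} {n : ℕ} {a : A} {p q : σ} {z : ℤ} :
    (𝒰.eval n).wt a p q = (z : ZMax) ↔
      ∃ b : ℤ, 𝒰.base a p q = (b : ZMax) ∧ z = b + 𝒰.slope a p q * n := by
  change 𝒰.base a p q + ((𝒰.slope a p q * n : ℤ) : ZMax) = _ ↔ _
  induction 𝒰.base a p q using WithBot.recBotCoe with
  | bot => simp
  | coe b =>
    rw [← WithBot.coe_add, WithBot.coe_inj]
    simp [eq_comm]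

/-- The constant of the constraint `k.1` is increased by `k.2 * n`. -/
def shiftConstraint (n : ℕ) (k : Constraint × ℤ) : Constraint :=
  ⟨k.1.types, k.1.a, k.1.b, k.1.c + k.2 * n⟩

/-- The constraints depend on a parameter only through their constants, with slopes `-1`, `0`
or `1`. -/
def AffineConstraints (F : ℕ → List Constraint) : Prop :=
  ∃ l : List (Constraint × ℤ), (∀ k ∈ l, |k.2| ≤ 1) ∧ ∀ n, F n = l.map (shiftConstraint n)

theorem AffineConstraints.const (l : List Constraint) : AffineConstraints fun _ => l := by
  refine ⟨l.map fun k => (k, 0), ?_, fun n => ?_⟩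
  · intro k hk
    obtain ⟨k, -, rfl⟩ := List.mem_map.1 hk
    simp
  · rw [List.map_map]
    have : (shiftConstraint n ∘ fun k => (k, 0)) = id := by
      funext k; simp [shiftConstraint]
    rw [this, List.map_id]

theorem AffineConstraints.append {F G : ℕ → List Constraint} (hF : AffineConstraints F)
    (hG : AffineConstraints G) : AffineConstraints fun n => F n ++ G n := by
  obtain ⟨l, hl, hl'⟩ := hF
  obtain ⟨k, hk, hk'⟩ := hG
  refine ⟨l ++ k, ?_, fun n => by
    rw [List.map_append, ← hl', ← hk']⟩
  intro x hx
  exact (List.mem_append.1 hx).elim (hl x) (hk x)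

theorem AffineConstraints.eqCon_neg (T : List (Option (Fin 5))) (a b : Fin 5 → ℤ) :
    AffineConstraints fun n => eqCon T a b (-n) := by
  refine ⟨[(leCon T a b 0, -1), (leCon T (fun i => -a i) (fun i => -b i) 0, 1)], by simp,
    fun n => ?_⟩
  simp only [eqCon, leCon, shiftConstraint, List.map_cons, List.map_nil, List.cons.injEq,
    Constraint.mk.injEq, true_and, and_true]
  constructor <;> ring

theorem affineConstraints_machine (B K P₀ : ℕ) :
    AffineConstraints (machineConstraints B K P₀) := by
  unfold machineConstraints
  refine .append (.const _) ?_
  iterate 15 refine .append (.const _) ?_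
  exact .eqCon_neg _ _ _

theorem length_machineConstraints (B K P₀ n : ℕ) :
    (machineConstraints B K P₀ n).length = 36 := rfl

/-- A constraint that always holds. -/
def trivialConstraint : Constraint := ⟨fun _ => false, 0, 0, 0⟩

/-- There is a family of automata with six letters and `554` states, with weights affine in a
parameter `n`, for which it is undecidable from `n` whether each word has a nonnegative path. -/
theorem exists_undecidable_family :
    ∃ (𝒰 : AffineAut (Option (Fin 5)) (CheckState 54)) (o : CheckState 54),
      (∀ a p q, |𝒰.slope a p q| ≤ 1) ∧
      (∀ n (a : Fin 6), (𝒰.eval n).wt (finSuccEquiv 5 a) o o = (((a : ℕ) : ℤ) : ZMax)) ∧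
      𝒰.fin o = false ∧ ¬ ComputablePred fun n => ∀ s, (𝒰.eval n).Nonneg s := by
  classical
  obtain ⟨B, K, rules, hB, hK, hr, hU⟩ := exists_undecidable_rules
  set P₀ := Nat.ofDigits (4 * (B * (B * (K * K)))) (rules.map (Rule.code B K)) with hP₀
  obtain ⟨l, hl, hl'⟩ := affineConstraints_machine B K P₀
  let k : Fin 54 → Constraint × ℤ := fun i => l.getD i (trivialConstraint, 0)
  have hk : ∀ i, |(k i).2| ≤ 1 := by
    intro i
    by_cases hi : (i : ℕ) < l.length
    · simp only [k, List.getD_eq_getElem _ _ hi]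
      exact hl _ (List.getElem_mem hi)
    · simp only [k, List.getD_eq_default _ _ (not_lt.1 hi)]
      simp
  let κ : ℕ → Fin 54 → Constraint := fun n i => shiftConstraint n (k i)
  have hlen : l.length = 36 := by
    have := length_machineConstraints B K P₀ 0
    rw [hl', List.length_map] at this
    exact this
  have hκ : ∀ n (P : Constraint → Prop), (∀ m, P (shiftConstraint m (trivialConstraint, 0))) →
      ((∀ i, P (κ n i)) ↔ ∀ c ∈ machineConstraints B K P₀ n, P c) := by
    intro n P hP
    rw [hl']
    constructor
    · intro h c hc
      obtain ⟨x, hx, rfl⟩ := List.mem_map.1 hc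
      obtain ⟨i, hi, rfl⟩ := List.getElem_of_mem hx
      have := h ⟨i, by omega⟩
      simpa only [κ, k, List.getD_eq_getElem _ _ hi] using this
    · intro h i
      by_cases hi : (i : ℕ) < l.length
      · simp only [κ, k, List.getD_eq_getElem _ _ hi]
        exact h _ (List.mem_map_of_mem (List.getElem_mem hi))
      · simp only [κ, k, List.getD_eq_default _ _ (not_lt.1 hi)]
        exact hP _
  have hhalt : ∀ n, (∃ w, ¬ (checker (κ n)).Nonneg w) ↔ NumHalts B rules n := by
    intro n
    rw [exists_word_iff, ← linHalts_iff hB hK hr n]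
    unfold LinHalts
    have h1 : ∀ t x y, (∀ i, (κ n i).Holds t x y) ↔
        ∀ c ∈ machineConstraints B K P₀ n, c.Holds t x y := fun t x y =>
      hκ n (fun c => c.Holds t x y) (fun _ h => absurd h (by simp [trivialConstraint,
        shiftConstraint]))
    simp only [h1, hP₀]
  -- the only weights that depend on `n` are those of the moves to the state `inr 6`
  let slope : Option (Fin 5) → CheckState 54 → CheckState 54 → ℤ
    | some _, .inl (i, true, 4), .inr 6 => (k i).2
    | _, _, _ => 0
  let 𝒰 : AffineAut (Option (Fin 5)) (CheckState 54) :=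
    ⟨checkWt (κ 0), slope, (checker (κ 0)).init, (checker (κ 0)).fin⟩
  have hwt : ∀ n, 𝒰.eval n = checker (κ n) := by
    intro n
    have h1 : ∀ a p q, checkWt (κ 0) a p q + ((slope a p q * n : ℤ) : ZMax) =
        checkWt (κ n) a p q := by
      intro a p q
      have same : checkMove (κ 0) a p = checkMove (κ n) a p → slope a p q = 0 →
          checkWt (κ 0) a p q + ((slope a p q * n : ℤ) : ZMax) = checkWt (κ n) a p q := by
        intro h1 h2
        rw [h2, zero_mul, WithBot.coe_zero, add_zero]
        unfold checkWt
        rw [h1]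
      rcases p with ⟨i, h, j⟩ | j
      · rcases a with _ | t
        · cases h
          · exact same rfl rfl
          · exact same rfl rfl
        · cases h
          · fin_cases j <;> exact same rfl rfl
          · fin_cases j
            · exact same rfl rfl
            · exact same rfl rfl
            · exact same rfl rfl
            · exact same rfl rfl
            · have h1 : ∀ m, checkWt (κ m) (some t) (.inl (i, true, 4)) q =
                  if .inr 6 = q then (((κ m i).c : ℤ) : ZMax) else ⊥ := fun m => rfl
              change checkWt (κ 0) (some t) (.inl (i, true, 4)) q +
                ((slope (some t) (.inl (i, true, 4)) q * n : ℤ) : ZMax) =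
                checkWt (κ n) (some t) (.inl (i, true, 4)) q
              rw [h1, h1]
              by_cases hq : .inr 6 = q
              · subst hq
                simp only [if_true, κ, shiftConstraint, slope]
                rw [← WithBot.coe_add]
                simp
              · simp [hq]
      · refine same ?_ ?_
        · cases a <;> fin_cases j <;> rfl
        · cases a <;> rfl
    have h2 : (𝒰.eval n).wt = (checker (κ n)).wt := by
      funext a p q; exact h1 a p q
    have h3 : (𝒰.eval n).init = (checker (κ n)).init := rfl
    have h4 : (𝒰.eval n).fin = (checker (κ n)).fin := rfl
    cases h5 : 𝒰.eval n
    cases h6 : checker (κ n)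
    rw [h5, h6] at h2 h3 h4
    dsimp only at h2 h3 h4
    rw [h2, h3, h4]
  refine ⟨𝒰, .inr 7, ?_, ?_, rfl, ?_⟩
  · intro a p q
    change |slope a p q| ≤ 1
    dsimp only [slope]
    split
    · exact hk _
    · simp
  · intro n a
    rw [hwt]
    change checkWt _ _ _ _ = _
    rw [checkWt_eq_iff]
    refine Or.inr ?_
    refine Fin.cases ?_ (fun t => ?_) a
    · rfl
    · rw [finSuccEquiv_succ]
      simp [checkMove]
  · intro h
    apply hU
    have h2 := h.not
    refine h2.of_eq fun n => ?_
    rw [← hhalt n, hwt]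
    push Not
    rfl

/-! ### Coding in two letters with small weights -/

section Binary

/-- The weight `b + ε * n` is spread over the steps of a block: `ε` on the steps before `n`, then
the sign of `b` on `|b|` steps. -/
def stepWeight (b ε : ℤ) (n j : ℕ) : ℤ :=
  if j < n then ε else if j - n < b.natAbs then b.sign else 0

theorem sum_stepWeight {b ε : ℤ} {n c : ℕ} (hb : b.natAbs ≤ c) :
    ∑ j ∈ Finset.range (n + c), stepWeight b ε n j = b + ε * n := by
  rw [Finset.sum_range_add]
  have h1 : ∑ j ∈ Finset.range n, stepWeight b ε n j = ε * n := by
    rw [Finset.sum_congr rfl (g := fun _ => ε) (fun j hj => by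
      simp [stepWeight, Finset.mem_range.1 hj])]
    simp [mul_comm]
  have h2 : ∑ j ∈ Finset.range c, stepWeight b ε n (n + j) = b := by
    have h3 : ∀ j, stepWeight b ε n (n + j) = if j < b.natAbs then b.sign else 0 := by
      intro j; simp [stepWeight]
    simp only [h3]
    obtain ⟨e, rfl⟩ := Nat.exists_eq_add_of_le hb
    rw [Finset.sum_range_add]
    have h4 : ∑ j ∈ Finset.range b.natAbs, (if j < b.natAbs then b.sign else 0) = b := by
      rw [Finset.sum_congr rfl (g := fun _ => b.sign) (fun j hj => by
        simp [Finset.mem_range.1 hj])]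
      rw [Finset.sum_const, Finset.card_range, nsmul_eq_mul, mul_comm, Int.sign_mul_natAbs]
    rw [h4]
    simp
  rw [h1, h2, add_comm]

/-- Compatibility of the bit `β` in position `j` of a block with the letter `i`. A block stands for
the letter `i < 5` if its first `1` is in position `i`, and for the letter `5` if it begins with
five zeros. -/
def bitAllowed (i : Fin 6) (j : ℕ) (β : Bool) : Bool :=
  (decide ((i : ℕ) ≤ j) || !β) && ((decide (j ≠ i) || decide (5 ≤ (i : ℕ))) || β)

/-- The bits of `l` in positions `j, j + 1, …` are compatible with the letter `i`. -/
def Decodes (i : Fin 6) : ℕ → List Bool → Prop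
  | _, [] => True
  | j, β :: l => bitAllowed i j β = true ∧ Decodes i (j + 1) l

theorem decodes_of_le (i : Fin 6) (j : ℕ) (hj : 6 ≤ j) (l : List Bool) : Decodes i j l := by
  induction l generalizing j with
  | nil => trivial
  | cons β l ih =>
    refine ⟨?_, ih _ (by omega)⟩
    have := i.is_lt
    have h1 : (i : ℕ) ≤ j := by omega
    have h2 : j ≠ i := by omega
    simp [bitAllowed, h1, h2]

theorem existsUnique_decodes (l : List Bool) (hl : 6 ≤ l.length) : ∃! i, Decodes i 0 l := by
  match l, hl with
  | b0 :: b1 :: b2 :: b3 :: b4 :: b5 :: l, hl =>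
    have h : ∀ i, Decodes i 6 l := fun i => decodes_of_le i 6 le_rfl l
    simp only [Decodes, zero_add, Nat.reduceAdd, h, and_true]
    have key : ∀ b0 b1 b2 b3 b4 b5 : Bool, ∃ i : Fin 6, ∀ k : Fin 6,
        (bitAllowed k 0 b0 && (bitAllowed k 1 b1 && (bitAllowed k 2 b2 && (bitAllowed k 3 b3 &&
          (bitAllowed k 4 b4 && bitAllowed k 5 b5))))) = decide (k = i) := by
      decide
    obtain ⟨i, hi⟩ := key b0 b1 b2 b3 b4 b5
    simp only [← Bool.and_eq_true, hi, decide_eq_true_eq]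
    exact ⟨i, rfl, fun _ h => h⟩

theorem decodes_code (i : Fin 6) (j m : ℕ) :
    Decodes i j ((List.range' j m).map fun k => decide (k = (i : ℕ))) := by
  induction m generalizing j with
  | zero => trivial
  | succ m ih =>
    rw [List.range'_succ, List.map_cons]
    refine ⟨?_, ih _⟩
    by_cases h : j = i
    · simp [bitAllowed, h]
    · simp [bitAllowed, h]

open Classical in
/-- The letter that a block stands for. -/
noncomputable def decodeBlock (l : List Bool) : Fin 6 :=
  if h : ∃ i, Decodes i 0 l then h.choose else 0

theorem decodes_iff {l : List Bool} (hl : 6 ≤ l.length) (i : Fin 6) :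
    Decodes i 0 l ↔ i = decodeBlock l := by
  obtain ⟨k, hk, hk'⟩ := existsUnique_decodes l hl
  have h : ∃ i, Decodes i 0 l := ⟨k, hk⟩
  have h1 : Decodes (decodeBlock l) 0 l := by
    rw [decodeBlock, dif_pos h]; exact h.choose_spec
  constructor
  · intro hi; rw [hk' i hi, hk' _ h1]
  · rintro rfl; exact h1

variable {A σ : Type} [DecidableEq σ] (𝒰 : AffineAut A σ) (f : Fin 6 ≃ A) (c n : ℕ)

/-- The states of the binary automaton, apart from the position in a block. In a state
`inl (p, i, q)` a block is read that stands for the letter `i`, to simulate the transition from `p`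
to `q`; the state `inr 0` keeps the position only, and the state `inr 1` is isolated. -/
abbrev BinState (σ : Type) : Type := (σ × Fin 6 × σ) ⊕ Fin 2

/-- The weights of the binary automaton, with blocks of length `n + c`. The positions in a block are
`j` and `j'`. -/
def binWt (β : Bool) (j : ℕ) (x : BinState σ) (j' : ℕ) (x' : BinState σ) : ZMax :=
  match x, x' with
  | .inl (p, i, q), .inl (p', i', q') =>
    if bitAllowed i j β = true ∧ ((j + 1 < n + c ∧ j' = j + 1 ∧ (p, i, q) = (p', i', q')) ∨
        (j + 1 = n + c ∧ j' = 0 ∧ q = p')) then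
      (𝒰.base (f i) p q).map fun b => stepWeight b (𝒰.slope (f i) p q) n j
    else ⊥
  | .inr 0, .inr 0 =>
    if (j + 1 < n + c ∧ j' = j + 1) ∨ (j + 1 = n + c ∧ j' = 0) then 0 else ⊥
  | .inr 1, .inr 1 => if j = j' then (if β then 1 else 0) else ⊥
  | _, _ => ⊥

/-- The initial states of the binary automaton, in position `j` of a block. -/
def binInit (j : ℕ) : BinState σ → Bool
  | .inl (p, _, _) => decide (j = 0) && 𝒰.init p
  | .inr 0 => decide (j = 0)
  | .inr 1 => false

/-- The final states of the binary automaton, in position `j` of a block. -/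
def binFin (j : ℕ) : BinState σ → Bool
  | .inl (p, _, _) => decide (j = 0) && 𝒰.fin p
  | .inr 0 => decide (j ≠ 0)
  | .inr 1 => false

/-- The binary automaton that simulates the automaton `𝒰.eval n`. Words whose length is not a
multiple of the length of the blocks have a path of weight `0`. -/
def binAut : MaxPlusAut Bool (Fin (n + c) × BinState σ) where
  wt β x y := binWt 𝒰 f c n β x.1 x.2 y.1 y.2
  init x := binInit 𝒰 x.1 x.2
  fin x := binFin 𝒰 x.1 x.2

variable {𝒰 f c n}

theorem binWt_inl_iff {β : Bool} {j j' : ℕ} {p q : σ} {i : Fin 6} {x' : BinState σ} {z : ℤ} :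
    binWt 𝒰 f c n β j (.inl (p, i, q)) j' x' = (z : ZMax) ↔
      bitAllowed i j β = true ∧ (∃ b : ℤ, 𝒰.base (f i) p q = (b : ZMax) ∧
        z = stepWeight b (𝒰.slope (f i) p q) n j) ∧
      ((j + 1 < n + c ∧ j' = j + 1 ∧ x' = .inl (p, i, q)) ∨
        (j + 1 = n + c ∧ j' = 0 ∧ ∃ i' q', x' = .inl (q, i', q'))) := by
  rcases x' with ⟨p', i', q'⟩ | k
  · have hmap : ((𝒰.base (f i) p q).map fun b => stepWeight b (𝒰.slope (f i) p q) n j) =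
        (z : ZMax) ↔ ∃ b : ℤ, 𝒰.base (f i) p q = (b : ZMax) ∧
          z = stepWeight b (𝒰.slope (f i) p q) n j := by
      induction 𝒰.base (f i) p q using WithBot.recBotCoe with
      | bot => simp
      | coe b =>
        rw [WithBot.map_coe, WithBot.coe_inj]
        simp [eq_comm]
    rw [← hmap]
    unfold binWt
    dsimp only
    split_ifs with h
    · obtain ⟨h1, h2⟩ := h
      simp only [h1, true_and]
      refine (and_iff_left ?_).symm
      rcases h2 with ⟨h3, h4, h5⟩ | ⟨h3, h4, rfl⟩
      · exact Or.inl ⟨h3, h4, by rw [h5]⟩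
      · exact Or.inr ⟨h3, h4, i', q', rfl⟩
    · refine ⟨fun h' => absurd h' (by simp), ?_⟩
      rintro ⟨h1, -, h2⟩
      refine absurd ⟨h1, ?_⟩ h
      rcases h2 with ⟨h3, h4, h5⟩ | ⟨h3, h4, i'', q'', h5⟩
      · exact Or.inl ⟨h3, h4, (Sum.inl_injective h5).symm⟩
      · exact Or.inr ⟨h3, h4, (congrArg Prod.fst (Sum.inl_injective h5)).symm⟩
  · simp [binWt]

theorem path_bin_inl {l : List Bool} {j : Fin (n + c)} {p q : σ} {i : Fin 6}
    {y : Fin (n + c) × BinState σ} {z : ℤ} (hl : l ≠ []) (hj : (j : ℕ) + l.length = n + c) :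
    Path (binAut 𝒰 f c n).wt l (j, .inl (p, i, q)) y z ↔
      Decodes i j l ∧ (∃ b : ℤ, 𝒰.base (f i) p q = (b : ZMax) ∧
        z = ∑ k ∈ Finset.range l.length, stepWeight b (𝒰.slope (f i) p q) n (j + k)) ∧
      (y.1 : ℕ) = 0 ∧ ∃ i' q', y.2 = .inl (q, i', q') := by
  induction l generalizing j z with
  | nil => exact absurd rfl hl
  | cons β l ih =>
    have hwt : ∀ r x, (binAut 𝒰 f c n).wt β (j, .inl (p, i, q)) r = ((x : ℤ) : ZMax) ↔ _ :=
      fun r x => binWt_inl_iff (β := β) (j := j) (j' := r.1) (p := p) (q := q) (i := i)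
        (x' := r.2) (z := x)
    simp only [Path, hwt, Decodes]
    by_cases hl' : l = []
    · subst hl'
      simp only [Path, List.length_cons, List.length_nil, zero_add, Finset.sum_range_one,
        add_zero, Decodes, and_true] at hj ⊢
      constructor
      · rintro ⟨r, x, y, ⟨h1, ⟨b, h2, rfl⟩, h3⟩, ⟨rfl, rfl⟩, rfl⟩
        refine ⟨h1, ⟨b, h2, by ring⟩, ?_⟩
        rcases h3 with ⟨h3, -⟩ | ⟨-, h4, h5⟩
        · omega
        · exact ⟨h4, h5⟩
      · rintro ⟨h1, ⟨b, h2, rfl⟩, h4, h5⟩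
        exact ⟨y, _, 0, ⟨h1, ⟨b, h2, rfl⟩, Or.inr ⟨hj, h4, h5⟩⟩, ⟨rfl, rfl⟩, by ring⟩
    · have hlen : 0 < l.length := List.length_pos_iff.2 hl'
      rw [List.length_cons] at hj
      have hj1 : (j : ℕ) + 1 < n + c := by omega
      have hih := fun z => ih (j := ⟨j + 1, hj1⟩) (z := z) hl' (by dsimp only; omega)
      have hsum : ∀ b : ℤ, ∑ k ∈ Finset.range (l.length + 1),
          stepWeight b (𝒰.slope (f i) p q) n (j + k) =
          ∑ k ∈ Finset.range l.length, stepWeight b (𝒰.slope (f i) p q) n (j + 1 + k) +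
            stepWeight b (𝒰.slope (f i) p q) n j := by
        intro b
        rw [Finset.sum_range_succ', add_zero]
        congr 1
        refine Finset.sum_congr rfl fun k _ => ?_
        congr 1; omega
      simp only [List.length_cons, hsum]
      constructor
      · rintro ⟨r, x, y', ⟨h1, ⟨b, h2, rfl⟩, h3⟩, h4, rfl⟩
        rcases h3 with ⟨-, h5, h6⟩ | ⟨h5, -⟩
        · obtain rfl : r = (⟨j + 1, hj1⟩, .inl (p, i, q)) := Prod.ext (Fin.ext h5) h6
          obtain ⟨h7, ⟨b', h8, rfl⟩, h9⟩ := (hih _).1 h4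
          obtain rfl : b = b' := WithBot.coe_injective (h2.symm.trans h8)
          exact ⟨⟨h1, h7⟩, ⟨b, h2, by ring⟩, h9⟩
        · omega
      · rintro ⟨⟨h1, h7⟩, ⟨b, h2, rfl⟩, h9⟩
        exact ⟨(⟨j + 1, hj1⟩, .inl (p, i, q)), _, _, ⟨h1, ⟨b, h2, rfl⟩, Or.inl ⟨hj1, rfl, rfl⟩⟩,
          (hih _).2 ⟨h7, ⟨b, h2, rfl⟩, h9⟩, by ring⟩

/-- A path along a sequence of blocks simulates a path along the letters that they stand for. -/
theorem path_bin_flatten (hc : 6 ≤ c)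
    (hbase : ∀ a p q (b : ℤ), 𝒰.base a p q = (b : ZMax) → b.natAbs ≤ c)
    (bs : List (List Bool)) (hbs : ∀ l ∈ bs, l.length = n + c) (o : Fin (n + c))
    (ho : (o : ℕ) = 0) (p p' : σ) (z : ℤ) :
    (∃ i q y, Path (binAut 𝒰 f c n).wt bs.flatten (o, .inl (p, i, q)) (o, .inl (p', y)) z) ↔
      Path (𝒰.eval n).wt (bs.map fun l => f (decodeBlock l)) p p' z := by
  induction bs generalizing p z with
  | nil =>
    simp only [List.flatten_nil, List.map_nil, Path]
    constructor
    · rintro ⟨i, q, y, h, rfl⟩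
      exact ⟨congrArg Prod.fst (Sum.inl_injective (congrArg Prod.snd h)), rfl⟩
    · rintro ⟨rfl, rfl⟩
      exact ⟨0, p, (0, p), rfl, rfl⟩
  | cons l bs ih =>
    have hl : l.length = n + c := hbs l (by simp)
    have hl0 : l ≠ [] := by
      rintro rfl; simp at hl; omega
    have hih := fun p z => ih (fun l h => hbs l (List.mem_cons_of_mem _ h)) p z
    simp only [List.flatten_cons, List.map_cons, Path, path_append, eval_wt_iff]
    constructor
    · rintro ⟨i, q, y, r, x, x', h1, h2, rfl⟩
      rw [path_bin_inl hl0 (by omega)] at h1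
      obtain ⟨h3, ⟨b, h4, rfl⟩, h5, i', q', h6⟩ := h1
      rw [ho, decodes_iff (by omega)] at h3
      subst h3
      obtain rfl : r = (o, .inl (q, i', q')) := Prod.ext (Fin.ext (h5.trans ho.symm)) h6
      refine ⟨q, _, x', ⟨b, h4, rfl⟩, (hih q x').1 ⟨i', q', y, h2⟩, ?_⟩
      simp only [ho, zero_add]
      rw [hl, sum_stepWeight (hbase _ _ _ _ h4)]
    · rintro ⟨q, x, x', ⟨b, h4, rfl⟩, h2, rfl⟩
      obtain ⟨i', q', y, h⟩ := (hih q x').2 h2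
      refine ⟨decodeBlock l, q, y, (o, .inl (q, i', q')), _, x', ?_, h, rfl⟩
      rw [path_bin_inl hl0 (by omega), ho, decodes_iff (by omega)]
      refine ⟨rfl, ⟨b, h4, ?_⟩, rfl, i', q', rfl⟩
      simp only [zero_add]
      rw [hl, sum_stepWeight (hbase _ _ _ _ h4)]

theorem path_bin_clock {w : List Bool} {j : Fin (n + c)} {y : Fin (n + c) × BinState σ} {z : ℤ} :
    Path (binAut 𝒰 f c n).wt w (j, .inr 0) y z ↔
      z = 0 ∧ y.2 = .inr 0 ∧ (y.1 : ℕ) = (j + w.length) % (n + c) := by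
  induction w generalizing j z with
  | nil =>
    simp only [Path, List.length_nil, add_zero, Nat.mod_eq_of_lt j.is_lt]
    constructor
    · rintro ⟨rfl, rfl⟩; exact ⟨rfl, rfl, rfl⟩
    · rintro ⟨rfl, h1, h2⟩
      exact ⟨(Prod.ext (Fin.ext h2) h1).symm, rfl⟩
  | cons β w ih =>
    have hj := j.is_lt
    have hnext : (j + 1) % (n + c) < n + c := Nat.mod_lt _ (by omega)
    have hwt : ∀ r x, (binAut 𝒰 f c n).wt β (j, .inr 0) r = ((x : ℤ) : ZMax) ↔
        x = 0 ∧ r = (⟨(j + 1) % (n + c), hnext⟩, .inr 0) := by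
      rintro ⟨j', x' | k⟩ x
      · change (⊥ : ZMax) = _ ↔ _
        simp
      · fin_cases k
        · change (if ((j : ℕ) + 1 < n + c ∧ (j' : ℕ) = j + 1) ∨
            ((j : ℕ) + 1 = n + c ∧ (j' : ℕ) = 0) then (0 : ZMax) else ⊥) = _ ↔ _
          have hmod : (((j : ℕ) + 1 < n + c ∧ (j' : ℕ) = j + 1) ∨
              ((j : ℕ) + 1 = n + c ∧ (j' : ℕ) = 0)) ↔ (j' : ℕ) = (j + 1) % (n + c) := by
            rcases Nat.lt_or_ge ((j : ℕ) + 1) (n + c) with h | h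
            · rw [Nat.mod_eq_of_lt h]; omega
            · have : (j : ℕ) + 1 = n + c := by omega
              rw [this, Nat.mod_self]; omega
          simp only [hmod, Prod.mk.injEq, Fin.ext_iff]
          split_ifs with h
          · have h0 : (0 : ZMax) = (x : ZMax) ↔ x = 0 := by
              rw [← WithBot.coe_zero, WithBot.coe_inj, eq_comm]
            rw [h0]
            simp [h]
          · simp [h]
        · change (⊥ : ZMax) = _ ↔ _
          simp
    simp only [Path, hwt]
    constructor
    · rintro ⟨r, x, y', ⟨rfl, rfl⟩, h, rfl⟩
      obtain ⟨rfl, h1, h2⟩ := ih.1 h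
      refine ⟨rfl, h1, ?_⟩
      rw [h2, List.length_cons, Nat.mod_add_mod]
      congr 1; omega
    · rintro ⟨rfl, h1, h2⟩
      refine ⟨_, 0, 0, ⟨rfl, rfl⟩, ih.2 ⟨rfl, h1, ?_⟩, rfl⟩
      rw [h2, List.length_cons, Nat.mod_add_mod]
      congr 1; omega

theorem path_bin_inl_inl {w : List Bool} {j : Fin (n + c)} {x : σ × Fin 6 × σ}
    {y : Fin (n + c) × BinState σ} {z : ℤ}
    (h : Path (binAut 𝒰 f c n).wt w (j, .inl x) y z) : ∃ x', y.2 = .inl x' := by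
  induction w generalizing j x z with
  | nil =>
    obtain ⟨rfl, -⟩ := h
    exact ⟨x, rfl⟩
  | cons β w ih =>
    obtain ⟨r, a, b, h1, h2, -⟩ := h
    obtain ⟨p, i, q⟩ := x
    obtain ⟨j', x'⟩ := r
    obtain ⟨-, -, ⟨-, -, rfl⟩ | ⟨-, -, i', q', rfl⟩⟩ := binWt_inl_iff.1 h1
    · exact ih h2
    · exact ih h2

theorem exists_blocks {N : ℕ} (m : ℕ) (w : List Bool) (hw : w.length = m * N) :
    ∃ bs : List (List Bool), (∀ l ∈ bs, l.length = N) ∧ bs.flatten = w := by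
  induction m generalizing w with
  | zero =>
    have : w = [] := List.eq_nil_of_length_eq_zero (by omega)
    exact ⟨[], by simp, by simp [this]⟩
  | succ m ih =>
    obtain ⟨bs, h1, h2⟩ := ih (w.drop N) (by rw [List.length_drop, hw, Nat.succ_mul]; omega)
    refine ⟨w.take N :: bs, ?_, by rw [List.flatten_cons, h2, List.take_append_drop]⟩
    intro l hl
    rcases List.mem_cons.1 hl with rfl | hl
    · rw [List.length_take, hw, Nat.succ_mul]; omega
    · exact h1 l hl

theorem nonneg_bin_flatten (hc : 6 ≤ c)
    (hbase : ∀ a p q (b : ℤ), 𝒰.base a p q = (b : ZMax) → b.natAbs ≤ c)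
    (bs : List (List Bool)) (hbs : ∀ l ∈ bs, l.length = n + c) :
    (binAut 𝒰 f c n).Nonneg bs.flatten ↔
      (𝒰.eval n).Nonneg (bs.map fun l => f (decodeBlock l)) := by
  have ho : 0 < n + c := by omega
  constructor
  · rintro ⟨⟨j, x⟩, ⟨j', x'⟩, z, hp, hq, hpath, hz⟩
    rcases x with ⟨p, i, q⟩ | k
    · obtain ⟨⟨p', y⟩, rfl⟩ := path_bin_inl_inl hpath
      simp only [binAut, binInit, binFin, Bool.and_eq_true, decide_eq_true_eq] at hp hq
      obtain rfl : j = j' := Fin.ext (hp.1.trans hq.1.symm)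
      exact ⟨p, p', z, hp.2, hq.2,
        (path_bin_flatten hc hbase bs hbs j hp.1 p p' z).1 ⟨i, q, y, hpath⟩, hz⟩
    · fin_cases k
      · simp only [binAut, binInit, binFin, Fin.zero_eta, decide_eq_true_eq] at hp
        obtain ⟨rfl, h1, h2⟩ := path_bin_clock.1 hpath
        dsimp only at h1 h2
        subst h1
        simp only [binAut, binInit, binFin, decide_eq_true_eq] at hq
        refine absurd ?_ hq
        have hlen : bs.flatten.length = bs.length * (n + c) := by
          clear hpath h2
          induction bs with
          | nil => simp
          | cons l bs ih =>
            rw [List.flatten_cons, List.length_append, hbs l (by simp),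
              ih (fun l h => hbs l (List.mem_cons_of_mem _ h)), List.length_cons]
            ring
        rw [h2, hp, hlen]
        simp
      · exact absurd hp (by simp [binAut, binInit, binFin])
  · rintro ⟨p, p', z, hp, hq, hpath, hz⟩
    obtain ⟨i, q, y, h⟩ := (path_bin_flatten hc hbase bs hbs ⟨0, ho⟩ rfl p p' z).2 hpath
    refine ⟨_, _, z, ?_, ?_, h, hz⟩
    · simpa [binAut, binInit, binFin] using (show 𝒰.init p = true from hp)
    · simpa [binAut, binInit, binFin] using (show 𝒰.fin p' = true from hq)

/-- The binary automaton has nonnegative paths for all words exactly when the automaton that it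
simulates has. -/
theorem forall_nonneg_bin_iff (hc : 6 ≤ c)
    (hbase : ∀ a p q (b : ℤ), 𝒰.base a p q = (b : ZMax) → b.natAbs ≤ c) :
    (∀ w, (binAut 𝒰 f c n).Nonneg w) ↔ ∀ s, (𝒰.eval n).Nonneg s := by
  have ho : 0 < n + c := by omega
  constructor
  · intro h s
    let block : A → List Bool := fun a =>
      (List.range' 0 (n + c)).map fun k => decide (k = (f.symm a : ℕ))
    have hblock : ∀ a, f (decodeBlock (block a)) = a := by
      intro a
      have h1 := decodes_code (f.symm a) 0 (n + c)
      rw [decodes_iff (by simp; omega)] at h1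
      rw [← h1, f.apply_symm_apply]
    have h1 := (nonneg_bin_flatten (f := f) hc hbase (s.map block) (by simp [block])).1 (h _)
    rw [List.map_map] at h1
    have h2 : (fun l => f (decodeBlock l)) ∘ block = id := funext hblock
    rwa [h2, List.map_id] at h1
  · intro h w
    by_cases hw : n + c ∣ w.length
    · obtain ⟨m, hm⟩ := hw
      obtain ⟨bs, h1, rfl⟩ := exists_blocks m w (by rw [hm, mul_comm])
      exact (nonneg_bin_flatten hc hbase bs h1).2 (h _)
    · refine ⟨(⟨0, ho⟩, .inr 0), (⟨w.length % (n + c), Nat.mod_lt _ ho⟩, .inr 0), 0, ?_, ?_, ?_,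
        le_rfl⟩
      · simp [binAut, binInit, binFin]
      · simp only [binAut, binInit, binFin, decide_eq_true_eq]
        exact fun h0 => hw (Nat.dvd_of_mod_eq_zero h0)
      · rw [path_bin_clock]
        simp

end Binary

/-! ### Computability of the reductions -/

section Computability

theorem primrec_int_ofNat : Primrec fun n : ℕ => (n : ℤ) := by
  rw [← Primrec.encode_iff]
  refine (Primrec.nat_mul.comp (Primrec.const 2) Primrec.id).of_eq fun n => ?_
  change 2 * n = Equiv.natSumNatEquivNat (Equiv.intEquivNatSumNat (n : ℤ))
  rfl

theorem primrec_int_negSucc : Primrec Int.negSucc := by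
  rw [← Primrec.encode_iff]
  refine (Primrec.nat_add.comp (Primrec.nat_mul.comp (Primrec.const 2) Primrec.id)
    (Primrec.const 1)).of_eq fun n => ?_
  rfl

theorem primrec_int_sub : Primrec₂ fun m n : ℕ => (m : ℤ) - n := by
  have h : Primrec₂ fun m n : ℕ => if n ≤ m then ((m - n : ℕ) : ℤ) else
      Int.negSucc (n - m - 1) := by
    refine Primrec.ite (Primrec.nat_le.comp Primrec.snd Primrec.fst)
      (primrec_int_ofNat.comp Primrec.nat_sub) (primrec_int_negSucc.comp ?_)
    exact Primrec.nat_sub.comp (Primrec.nat_sub.comp Primrec.snd Primrec.fst) (Primrec.const 1)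
  refine h.of_eq fun m n => ?_
  split_ifs with hmn
  · push_cast [hmn]; rfl
  · rw [Int.negSucc_eq]; omega

theorem primrec_coe_zmax {α : Type} [Primcodable α] {f : α → ℤ} (hf : Primrec f) :
    Primrec fun a => (f a : ZMax) :=
  Primrec.option_some.comp hf

theorem primrec_affine (w : ZMax) (ε : ℤ) (hε : |ε| ≤ 1) :
    Primrec fun n : ℕ => w + ((ε * n : ℤ) : ZMax) := by
  induction w using WithBot.recBotCoe with
  | bot => simpa using Primrec.const (⊥ : ZMax)
  | coe z =>
    have h1 : Primrec fun n : ℕ => z + ε * n := by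
      have hz : z = (z.toNat : ℤ) - (-z).toNat := by omega
      obtain rfl | rfl | rfl : ε = -1 ∨ ε = 0 ∨ ε = 1 := by
        rw [abs_le] at hε; omega
      · refine (primrec_int_sub.comp (Primrec.const z.toNat)
          (Primrec.nat_add.comp (Primrec.const (-z).toNat) Primrec.id)).of_eq fun n => ?_
        simp only [id]; push_cast; omega
      · simpa using Primrec.const z
      · refine (primrec_int_sub.comp (Primrec.nat_add.comp (Primrec.const z.toNat) Primrec.id)
          (Primrec.const (-z).toNat)).of_eq fun n => ?_
        simp only [id]; push_cast; omega
    simpa only [WithBot.coe_add] using primrec_coe_zmax h1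

theorem primrec_select {α β : Type} [Primcodable α] [Primcodable β] {T : ℕ}
    {g : Fin T → α → β} (hg : ∀ k, Primrec (g k)) {idx : α → ℕ} (hidx : Primrec idx)
    (hlt : ∀ a, idx a < T) : Primrec fun a => g ⟨idx a, hlt a⟩ a := by
  rw [← Primrec.option_some_iff]
  refine (Primrec.list_getElem?.comp (Primrec.list_ofFn hg) hidx).of_eq fun a => ?_
  rw [List.getElem?_ofFn, dif_pos (hlt a)]

/-- The rows of a matrix given by a function on natural numbers. -/
def rowsOf (D : ℕ) (E : ℕ → ℕ → ZMax) : List (List ZMax) :=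
  (List.range D).map fun i => (List.range D).map fun j => E i j

theorem rows_eq_rowsOf {D : ℕ} (M : Mat D) (E : ℕ → ℕ → ZMax) (h : ∀ i j : Fin D, M i j = E i j) :
    (List.ofFn fun i => List.ofFn fun j => M i j) = rowsOf D E := by
  have key : ∀ {β : Type} (g : Fin D → β) (g' : ℕ → β), (∀ i : Fin D, g i = g' i) →
      List.ofFn g = (List.range D).map g' := by
    intro β g g' hg
    apply List.ext_getElem
    · simp
    · intro i h1 h2
      simp [hg]
  exact key _ _ fun i => key _ _ fun j => h i j

theorem primrec_rowsOf {D : ℕ → ℕ} (hD : Primrec D) {E : ℕ → ℕ → ℕ → ZMax}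
    (hE : Primrec fun x : ℕ × ℕ × ℕ => E x.1 x.2.1 x.2.2) :
    Primrec fun n => rowsOf (D n) (E n) := by
  refine Primrec.list_map (Primrec.list_range.comp hD) ?_
  refine Primrec.list_map (Primrec.list_range.comp (hD.comp Primrec.fst)) ?_
  exact hE.comp (Primrec.pair (Primrec.fst.comp Primrec.fst)
    (Primrec.pair (Primrec.snd.comp Primrec.fst) Primrec.snd))

/-- A decision procedure on a class of inputs decides a family of inputs in this class. -/
theorem DecidableOn.computablePred {C : Set Input} {p : Input → Prop} (h : DecidableOn C p)
    (x : ℕ → Input) (hx : ∀ n, x n ∈ C) (hcode : Computable fun n => (x n).code) :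
    ComputablePred fun n => p (x n) := by
  obtain ⟨f, hf, hfp⟩ := h
  rw [ComputablePred.computable_iff]
  refine ⟨fun n => f (x n).code, hf.comp hcode, ?_⟩
  funext n
  exact propext (hfp _ (hx n)).symm

/-- A procedure that names the joint spectral radius decides whether it is nonnegative. -/
theorem RadiusComputable.decidableOn (h : RadiusComputable) (C : Set Input) :
    DecidableOn C fun x => 0 ≤ x.radius := by
  obtain ⟨α, _, val, f, hval, hf, hfr⟩ := h
  obtain ⟨g, hg, hg'⟩ := ComputablePred.computable_iff.1 hval
  refine ⟨fun c => g (f c), hg.comp hf, fun x _ => ?_⟩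
  have hx : (0 ≤ val (f x.code)) = (g (f x.code) = true) := congrFun hg' (f x.code)
  rw [hfr x] at hx
  exact iff_of_eq hx.symm

theorem MaxPlusAut.toInput_code {A σ : Type} {k d : ℕ} (𝒜 : MaxPlusAut A σ) (f : Fin k ≃ A)
    (e : σ ≃ Fin d) (o : σ) (ho : ∀ a : Fin k, 𝒜.wt (f a) o o = (((a : ℕ) : ℤ) : ZMax))
    (hf : 𝒜.fin o = false) :
    (𝒜.toInput f e o ho hf).code =
      (List.ofFn fun i => List.ofFn fun j => toMat e (𝒜.resetWt none) i j) ::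
        List.ofFn fun a : Fin k => List.ofFn fun i => List.ofFn fun j =>
          toMat e (𝒜.wt (f a)) i j := by
  exact congrArg (List.cons _) (List.map_ofFn ..)

/-- Seven matrices of dimension `554`. -/
theorem not_decidableOn_inputsOfDim :
    ¬ DecidableOn (inputsOfDim 554 7 Set.univ) fun x => 0 ≤ x.radius := by
  intro h
  obtain ⟨𝒰, o, hs, ho, hf, hU⟩ := exists_undecidable_family
  have hcard : Fintype.card (CheckState 54) = 554 := by simp
  let e : CheckState 54 ≃ Fin 554 := Fintype.equivFinOfCardEq hcard
  let x : ℕ → Input := fun n =>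
    (𝒰.eval n).toInput (finSuccEquiv 5) e o (ho n) hf
  apply hU
  refine (h.computablePred x (fun n => ?_) ?_).of_eq fun n =>
    MaxPlusAut.zero_le_radius_toInput ..
  · refine ⟨⟨?_, fun _ _ _ _ => Set.mem_univ _⟩, rfl⟩
    exact (List.length_cons ..).trans (congrArg (· + 1) List.length_ofFn)
  · refine Primrec.to_comp (Primrec.of_eq ?_ fun n => (MaxPlusAut.toInput_code ..).symm)
    refine Primrec.list_cons.comp (Primrec.const (List.ofFn fun i => List.ofFn fun j =>
      toMat e ((𝒰.eval 0).resetWt none) i j)) ?_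
    exact Primrec.list_ofFn fun a => Primrec.list_ofFn fun i => Primrec.list_ofFn fun j =>
      primrec_affine _ _ (hs _ _ _)

end Computability

/-! ### Three matrices with small entries -/

section SmallEntries

/-- The numbering of the states of the binary automaton. -/
def binEquiv {τ : Type} {T : ℕ} (e : τ ≃ Fin T) (N : ℕ) : Fin N × τ ≃ Fin (N * T) :=
  (Equiv.prodCongr (Equiv.refl _) e).trans finProdFinEquiv

/-- The rows of a matrix indexed by positions and finitely many states depend computably on the
number of positions, if the entries do for each pair of states. -/
theorem primrec_rows_binEquiv {τ : Type} {T : ℕ} (e : τ ≃ Fin T) (hT : 0 < T) (c : ℕ)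
    (W : ℕ → ℕ → τ → ℕ → τ → ZMax)
    (hW : ∀ x x', Primrec fun v : ℕ × ℕ × ℕ => W v.1 v.2.1 x v.2.2 x') :
    Primrec fun n => List.ofFn fun i => List.ofFn fun j =>
      toMat (binEquiv e (n + c)) (fun y y' => W n y.1 y.2 y'.1 y'.2) i j := by
  have hmod : ∀ i, i % T < T := fun i => Nat.mod_lt _ hT
  let E : ℕ → ℕ → ℕ → ZMax := fun n i j =>
    W n (i / T) (e.symm ⟨i % T, hmod i⟩) (j / T) (e.symm ⟨j % T, hmod j⟩)
  have hE : Primrec fun v : ℕ × ℕ × ℕ => E v.1 v.2.1 v.2.2 := by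
    have hi : Primrec fun v : ℕ × ℕ × ℕ => v.2.1 := Primrec.fst.comp Primrec.snd
    have hj : Primrec fun v : ℕ × ℕ × ℕ => v.2.2 := Primrec.snd.comp Primrec.snd
    have hv : Primrec fun v : ℕ × ℕ × ℕ => (v.1, v.2.1 / T, v.2.2 / T) :=
      Primrec.pair Primrec.fst (Primrec.pair (Primrec.nat_div.comp hi (Primrec.const T))
        (Primrec.nat_div.comp hj (Primrec.const T)))
    have h1 : ∀ k k' : Fin T, Primrec fun v : ℕ × ℕ × ℕ =>
        W v.1 (v.2.1 / T) (e.symm k) (v.2.2 / T) (e.symm k') := fun k k' => (hW _ _).comp hv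
    have h2 : ∀ k : Fin T, Primrec fun v : ℕ × ℕ × ℕ =>
        W v.1 (v.2.1 / T) (e.symm k) (v.2.2 / T) (e.symm ⟨v.2.2 % T, hmod _⟩) := fun k =>
      primrec_select (g := fun k' v => W v.1 (v.2.1 / T) (e.symm k) (v.2.2 / T) (e.symm k'))
        (h1 k) (Primrec.nat_mod.comp hj (Primrec.const T)) fun v => hmod _
    exact primrec_select
      (g := fun k v => W v.1 (v.2.1 / T) (e.symm k) (v.2.2 / T) (e.symm ⟨v.2.2 % T, hmod _⟩))
      h2 (Primrec.nat_mod.comp hi (Primrec.const T)) fun v => hmod _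
  refine (primrec_rowsOf (D := fun n => (n + c) * T) ?_ hE).of_eq fun n => ?_
  · exact Primrec.nat_mul.comp (Primrec.nat_add.comp Primrec.id (Primrec.const c))
      (Primrec.const T)
  · exact (rows_eq_rowsOf _ _ fun i j => rfl).symm

variable {A σ : Type} (𝒰 : AffineAut A σ) (f : Fin 6 ≃ A) (c : ℕ)

theorem primrec_stepWeight (b ε : ℤ) : Primrec₂ fun n j => stepWeight b ε n j := by
  refine Primrec.ite (Primrec.nat_lt.comp Primrec.snd Primrec.fst) (Primrec.const ε) ?_
  exact Primrec.ite (Primrec.nat_lt.comp (Primrec.nat_sub.comp Primrec.snd Primrec.fst)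
    (Primrec.const _)) (Primrec.const _) (Primrec.const _)

theorem primrecPred_step :
    PrimrecPred fun v : ℕ × ℕ × ℕ => v.2.1 + 1 < v.1 + c ∧ v.2.2 = v.2.1 + 1 := by
  have hj : Primrec fun v : ℕ × ℕ × ℕ => v.2.1 + 1 :=
    Primrec.succ.comp (Primrec.fst.comp Primrec.snd)
  exact (Primrec.nat_lt.comp hj (Primrec.nat_add.comp Primrec.fst (Primrec.const c))).and
    (Primrec.eq.comp (Primrec.snd.comp Primrec.snd) hj)

theorem primrecPred_wrap :
    PrimrecPred fun v : ℕ × ℕ × ℕ => v.2.1 + 1 = v.1 + c ∧ v.2.2 = 0 := by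
  have hj : Primrec fun v : ℕ × ℕ × ℕ => v.2.1 + 1 :=
    Primrec.succ.comp (Primrec.fst.comp Primrec.snd)
  exact (Primrec.eq.comp hj (Primrec.nat_add.comp Primrec.fst (Primrec.const c))).and
    (Primrec.eq.comp (Primrec.snd.comp Primrec.snd) (Primrec.const 0))

theorem primrecPred_const {α : Type} [Primcodable α] (p : Prop) : PrimrecPred fun _ : α => p := by
  classical
  exact ⟨fun _ => inferInstance, Primrec.const _⟩

theorem primrecPred_bitAllowed (i : Fin 6) (β : Bool) :
    PrimrecPred fun j => bitAllowed i j β = true := by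
  have h : PrimrecPred fun j : ℕ => ((i : ℕ) ≤ j ∨ β = false) ∧
      ((j ≠ i ∨ 5 ≤ (i : ℕ)) ∨ β = true) :=
    ((Primrec.nat_le.comp (Primrec.const _) Primrec.id).or (primrecPred_const _)).and
      (((Primrec.eq.comp Primrec.id (Primrec.const _)).not.or (primrecPred_const _)).or
        (primrecPred_const _))
  exact h.of_eq fun j => by simp [bitAllowed]

theorem primrec_binWt [DecidableEq σ] (β : Bool) (x x' : BinState σ) :
    Primrec fun v : ℕ × ℕ × ℕ => binWt 𝒰 f c v.1 β v.2.1 x v.2.2 x' := by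
  have hj : Primrec fun v : ℕ × ℕ × ℕ => v.2.1 := Primrec.fst.comp Primrec.snd
  rcases x with ⟨p, i, q⟩ | k <;> rcases x' with ⟨p', i', q'⟩ | k'
  · refine Primrec.ite (((primrecPred_bitAllowed i β).comp hj).and (PrimrecPred.of_eq
      ((((primrecPred_step c).and (primrecPred_const ((p, i, q) = (p', i', q'))))).or
        ((primrecPred_wrap c).and (primrecPred_const (q = p')))) fun v => by
          simp only [and_assoc])) ?_ (Primrec.const ⊥)
    induction 𝒰.base (f i) p q using WithBot.recBotCoe with
    | bot => exact Primrec.const ⊥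
    | coe b => exact primrec_coe_zmax ((primrec_stepWeight b _).comp Primrec.fst hj)
  · exact Primrec.const ⊥
  · fin_cases k <;> exact Primrec.const ⊥
  · fin_cases k <;> fin_cases k'
    · exact Primrec.ite ((primrecPred_step c).or (primrecPred_wrap c)) (Primrec.const 0)
        (Primrec.const ⊥)
    · exact Primrec.const ⊥
    · exact Primrec.const ⊥
    · exact Primrec.ite (Primrec.eq.comp hj (Primrec.snd.comp Primrec.snd)) (Primrec.const _)
        (Primrec.const ⊥)

theorem binWt_mem [DecidableEq σ] (hs : ∀ a p q, |𝒰.slope a p q| ≤ 1) (n : ℕ) (β : Bool) (j : ℕ)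
    (x : BinState σ) (j' : ℕ) (x' : BinState σ) :
    binWt 𝒰 f c n β j x j' x' ∈ ({⊥, ((-1 : ℤ) : ZMax), 0, 1} : Set ZMax) := by
  have hbot : (⊥ : ZMax) ∈ ({⊥, ((-1 : ℤ) : ZMax), 0, 1} : Set ZMax) := Or.inl rfl
  have hstep : ∀ b ε : ℤ, |ε| ≤ 1 → (stepWeight b ε n j : ZMax) ∈
      ({⊥, ((-1 : ℤ) : ZMax), 0, 1} : Set ZMax) := by
    intro b ε hε
    have h : stepWeight b ε n j = -1 ∨ stepWeight b ε n j = 0 ∨ stepWeight b ε n j = 1 := by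
      unfold stepWeight
      rw [abs_le] at hε
      split_ifs
      · omega
      · rcases lt_trichotomy b 0 with h | rfl | h
        · simp [Int.sign_eq_neg_one_of_neg h]
        · simp
        · simp [Int.sign_eq_one_of_pos h]
      · simp
    rcases h with h | h | h <;> rw [h]
    · exact Or.inr (Or.inl rfl)
    · exact Or.inr (Or.inr (Or.inl rfl))
    · exact Or.inr (Or.inr (Or.inr rfl))
  unfold binWt
  split
  · split_ifs
    · rename_i p i q _ _ _ _
      have := hs (f i) p q
      induction 𝒰.base (f i) p q using WithBot.recBotCoe with
      | bot => exact hbot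
      | coe b => exact hstep b _ this
    · exact hbot
  · split_ifs <;> simp
  · split_ifs <;> simp
  · exact hbot

theorem primrecPred_binInit (x : BinState σ) : PrimrecPred fun j => binInit 𝒰 j x = true := by
  have h0 : PrimrecPred fun j : ℕ => j = 0 := Primrec.eq.comp Primrec.id (Primrec.const 0)
  rcases x with ⟨p, i, q⟩ | k
  · exact (h0.and (primrecPred_const (𝒰.init p = true))).of_eq fun j => by simp [binInit]
  · fin_cases k
    · exact h0.of_eq fun j => by simp [binInit]
    · exact primrecPred_const (α := ℕ) (false = true)

theorem primrecPred_binFin (x : BinState σ) : PrimrecPred fun j => binFin 𝒰 j x = true := by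
  have h0 : PrimrecPred fun j : ℕ => j = 0 := Primrec.eq.comp Primrec.id (Primrec.const 0)
  rcases x with ⟨p, i, q⟩ | k
  · exact (h0.and (primrecPred_const (𝒰.fin p = true))).of_eq fun j => by simp [binFin]
  · fin_cases k
    · exact h0.not.of_eq fun j => by simp [binFin]
    · exact primrecPred_const (α := ℕ) (false = true)

/-- Three matrices with entries in `{-∞, -1, 0, 1}`. -/
theorem not_decidableOn_inputs :
    ¬ DecidableOn (inputs 3 {⊥, ((-1 : ℤ) : ZMax), 0, 1}) fun x => 0 ≤ x.radius := by
  intro h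
  obtain ⟨𝒰, -, hs, -, -, hU⟩ := exists_undecidable_family
  let f : Fin 6 ≃ Option (Fin 5) := finSuccEquiv 5
  obtain ⟨D, hD⟩ := (Set.finite_range
    fun v : Option (Fin 5) × CheckState 54 × CheckState 54 =>
      ((𝒰.base v.1 v.2.1 v.2.2).unbotD 0).natAbs).bddAbove
  -- The constant part of the weights fits in the last `c` steps of a block.
  let c := 6 + D
  have hbase : ∀ a p q (b : ℤ), 𝒰.base a p q = (b : ZMax) → b.natAbs ≤ c := by
    intro a p q b hb
    have h1 := hD ⟨(a, p, q), rfl⟩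
    dsimp only at h1
    rw [hb, WithBot.unbotD_coe] at h1
    omega
  let e := Fintype.equivFin (BinState (CheckState 54))
  have hT : 0 < Fintype.card (BinState (CheckState 54)) := Fintype.card_pos
  have hpos : ∀ n, 0 < n + c := fun n => by omega
  have ho : ∀ n, ∀ a : Fin 2, (binAut 𝒰 f c n).wt (finTwoEquiv a) (⟨0, hpos n⟩, .inr 1)
      (⟨0, hpos n⟩, .inr 1) = (((a : ℕ) : ℤ) : ZMax) := by
    intro n a
    fin_cases a <;> rfl
  let x : ℕ → Input := fun n =>
    (binAut 𝒰 f c n).toInput finTwoEquiv (binEquiv e (n + c)) (⟨0, hpos n⟩, .inr 1) (ho n) rfl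
  apply hU
  refine (h.computablePred x (fun n => ⟨rfl, ?_⟩) ?_).of_eq fun n =>
    (MaxPlusAut.zero_le_radius_toInput ..).trans (forall_nonneg_bin_iff (by omega) hbase)
  · intro M hM i j
    rcases List.mem_cons.1 hM with rfl | hM
    · change (if _ then (0 : ZMax) else ⊥) ∈ _
      split_ifs <;> simp
    · obtain ⟨a, rfl⟩ := List.mem_ofFn.1 hM
      exact binWt_mem 𝒰 f c hs ..
  · refine Primrec.to_comp (Primrec.of_eq ?_ fun n => (MaxPlusAut.toInput_code ..).symm)
    refine Primrec.list_cons.comp ?_ (Primrec.list_ofFn fun a => ?_)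
    · refine primrec_rows_binEquiv e hT c (fun _ j x j' x' =>
        if binFin 𝒰 j x && binInit 𝒰 j' x' then 0 else ⊥) fun x x' => ?_
      refine Primrec.ite (PrimrecPred.of_eq (((primrecPred_binFin 𝒰 x).comp
        (Primrec.fst.comp Primrec.snd)).and ((primrecPred_binInit 𝒰 x').comp
          (Primrec.snd.comp Primrec.snd))) fun v => ?_) (Primrec.const 0) (Primrec.const ⊥)
      rw [Bool.and_eq_true]
    · exact primrec_rows_binEquiv e hT c (fun n j x j' x' =>
        binWt 𝒰 f c n (finTwoEquiv a) j x j' x') (primrec_binWt 𝒰 f c _)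

end SmallEntries

end TropicalJSR

/-- An algorithm that outputs names of joint spectral radii would decide whether they are
nonnegative, so the first part follows from the third. -/
theorem theorem4p3 :
    ¬ TropicalJSR.RadiusComputable ∧
    ¬ TropicalJSR.DecidableOn (TropicalJSR.inputs 3 {⊥, ((-1 : ℤ) : TropicalJSR.ZMax), 0, 1}) (fun x => 0 ≤ x.radius) ∧
    ¬ TropicalJSR.DecidableOn (TropicalJSR.inputsOfDim 554 7 Set.univ) (fun x => 0 ≤ x.radius) :=
  ⟨fun h => TropicalJSR.not_decidableOn_inputsOfDim (h.decidableOn _),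
    TropicalJSR.not_decidableOn_inputs, TropicalJSR.not_decidableOn_inputsOfDim⟩
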